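/- For a matrix $A\in\mathbb C^{n\times n}$ write $A\succeq 0$ if $A$ is Hermitian positive semidefinite, and let $\operatorname{Null}(A)=\{x\in\mathbb C^n: Ax=0\}$. **Property $\mathcal{IC}$.** Let $B_0,B_1,B_2,B_3$ be $n\times n$ Hermitian matrices, in this order. We say that Property $\mathcal{IC}$ holds for $B_0,B_1,B_2,B_3$ if there exist real numbers $\mu_1,\mu_2,\mu_3,\mu_4>0$ and vectors $x_1,x_2\in\mathbb C^n$ such that 1. $Z:=B_0+\mu_1B_1+\mu_2B_2+\mu_3B_3+\mu_4I_n\succeq0$ and $\operatorname{span}_{\mathbb C}\{x_1,x_2\}=\operatorname{Null}(Z)$; 2. $x_1^HB_1x_1=x_2^HB_1x_2=0$ and $\operatorname{Re}(x_1^HB_1x_2)\neq0$; 3. $x_1^HB_2x_1=x_2^HB_2x_2=0$, $\operatorname{Re}(x_1^HB_2x_2)=0$ and $\operatorname{Im}(x_1^HB_2x_2)\neq0$; 4. $x_1^HB_3x_1<0<x_2^HB_3x_2$. **Theorem.** Let $A_0,A_1,A_2,A_3$ be $n\times n$ Hermitian matrices. Then the following two statements are equivalent. (i) Both of the following hold: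 * (i.1) $\max\{x^HA_0x,\,x^HA_1x,\,x^HA_2x,\,x^HA_3x\}\ge0$ for all $x\in\mathbb C^n$; * (i.2) there exists a permutation $(j_0,j_1,j_2,j_3)$ of $(0,1,2,3)$ such that there is no $x\in\mathbb C^n$ with $$x^HA_{j_0}x<0,\qquad x^HA_{j_1}x=x^HA_{j_2}x=x^HA_{j_3}x=0,$$ and Property $\mathcal{IC}$ fails for $A_{j_0},A_{j_1},A_{j_2},A_{j_3}$. (ii) There exist real numbers $\mu_0,\mu_1,\mu_2,\mu_3\ge0$ with $\mu_0+\mu_1+\mu_2+\mu_3=1$ such that $\mu_0A_0+\mu_1A_1+\mu_2A_2+\mu_3A_3\succeq0$. -/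

import Mathlib

open scoped Matrix ComplexOrder

namespace HermForms

/-- The sesquilinear value `xᴴ B y`, for `x, y ∈ ℂⁿ`. -/
def sesq {n : ℕ} (B : Matrix (Fin n) (Fin n) ℂ) (x y : Fin n → ℂ) : ℂ :=
  star x ⬝ᵥ (B *ᵥ y)

/-- The quadratic form `xᴴ B x` as a real number. For Hermitian `B` the complex number `xᴴ B x`
is real, so taking the real part loses nothing: see `coe_form`. -/
def form {n : ℕ} (B : Matrix (Fin n) (Fin n) ℂ) (x : Fin n → ℂ) : ℝ :=
  (sesq B x x).re

theorem coe_form {n : ℕ} {B : Matrix (Fin n) (Fin n) ℂ} (hB : B.IsHermitian) (x : Fin n → ℂ) :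
    ((form B x : ℝ) : ℂ) = sesq B x x := by
  have h : (sesq B x x).im = 0 := hB.im_star_dotProduct_mulVec_self x
  exact Complex.ext (by simp [form]) (by simp [h])

/-- The null space of a matrix. -/
def null {n : ℕ} (B : Matrix (Fin n) (Fin n) ℂ) : Submodule ℂ (Fin n → ℂ) :=
  LinearMap.ker B.mulVecLin

/-- Property IC for the ordered quadruple `B₀, B₁, B₂, B₃` of Hermitian matrices. -/
def PropertyIC {n : ℕ} (B₀ B₁ B₂ B₃ : Matrix (Fin n) (Fin n) ℂ) : Prop :=
  ∃ (μ₁ μ₂ μ₃ μ₄ : ℝ) (x₁ x₂ : Fin n → ℂ),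
    (0 < μ₁ ∧ 0 < μ₂ ∧ 0 < μ₃ ∧ 0 < μ₄) ∧
    ((B₀ + μ₁ • B₁ + μ₂ • B₂ + μ₃ • B₃ + μ₄ • (1 : Matrix (Fin n) (Fin n) ℂ)).PosSemidef ∧
      Submodule.span ℂ {x₁, x₂} =
        null (B₀ + μ₁ • B₁ + μ₂ • B₂ + μ₃ • B₃ + μ₄ • (1 : Matrix (Fin n) (Fin n) ℂ))) ∧
    (form B₁ x₁ = 0 ∧ form B₁ x₂ = 0 ∧ (sesq B₁ x₁ x₂).re ≠ 0) ∧
    (form B₂ x₁ = 0 ∧ form B₂ x₂ = 0 ∧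
      (sesq B₂ x₁ x₂).re = 0 ∧ (sesq B₂ x₁ x₂).im ≠ 0) ∧
    (form B₃ x₁ < 0 ∧ 0 < form B₃ x₂)

end HermForms

/-!
Write `B₀, …, B₃` for the matrices in the order given by the permutation.

If a nonnegative combination is positive semidefinite, some index has positive weight, and it is
put first. Then `B₀` cannot be negative where the other three forms vanish, and Property IC fails,
because the combination would make a real multiple of `B₃` positive at both `x₁` and `x₂`
(`not_propertyIC`).

Conversely, if no convex combination is positive semidefinite, a separating hyperplane for the
convex hull of the joint numerical range gives `X ⪰ 0` with all `tr(Bᵢ X) < 0`. This is Slater's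
condition for minimizing `tr(B₀ X)` over `X ⪰ 0` with `tr X = 1` and `tr(Bᵢ X) ≤ 0`, so an optimal
`X` of value `-μ₄ < 0` and multipliers `μ₁, μ₂, μ₃ ≥ 0` exist (`exists_multipliers`):
`Z = B₀ + μ₁ B₁ + μ₂ B₂ + μ₃ B₃ + μ₄ I ⪰ 0`, and `X` lives on the null space `V` of `Z`. Positive
semidefinite matrices appear only as finite sums `∑ y yᴴ`, that is, as multisets of vectors. Such a
sum with `tr(C X) = tr(D X) = 0` can be rewritten with all `y` isotropic for both Hermitian forms
`C` and `D`, by unitary mixing of pairs (`exists_rank_one_decomposition`).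

If some multiplier vanishes, this decomposition gives one vector at which `B₀` is negative and the
other forms are nonpositive. Either all three of them vanish, which is excluded, or one is negative,
and a perturbation makes all four negative, which is excluded too (`false_of_multiplier_eq_zero`).

If all multipliers are positive, then `tr(Bᵢ X) = 0` for `i = 1, 2, 3`, while the three forms have
no common zero in `V`. The decomposition yields the two vectors `x₁, x₂` of Property IC; what needs
an argument is that they span `V`. With a third dimension in `V`, the forms `B₁` and `B₂` combine to
a complex form that is a Jordan block on the plane of `x₁, x₂`. Its zero set, affinely the real
surface `ū v + b v̄ + c u + e = 0` in `ℂ²`, contains an explicit curve that leads from `x₁` to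
`x₂` (`exists_curve_on_surface`). On this curve `B₃` changes sign, and so the three forms have a
common zero after all. Hence Property IC holds, against the hypothesis.
-/

namespace HermForms

open ComplexConjugate

variable {n : ℕ}

/-! ### The algebra of sesquilinear and quadratic forms -/

theorem sesq_add_left (B : Matrix (Fin n) (Fin n) ℂ) (x y z : Fin n → ℂ) :
    sesq B (x + y) z = sesq B x z + sesq B y z := by
  simp [sesq, add_dotProduct]

theorem sesq_add_right (B : Matrix (Fin n) (Fin n) ℂ) (x y z : Fin n → ℂ) :
    sesq B x (y + z) = sesq B x y + sesq B x z := by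
  simp [sesq, Matrix.mulVec_add, dotProduct_add]

theorem sesq_smul_left (B : Matrix (Fin n) (Fin n) ℂ) (c : ℂ) (x y : Fin n → ℂ) :
    sesq B (c • x) y = conj c * sesq B x y := by
  simp [sesq, smul_dotProduct]

theorem sesq_smul_right (B : Matrix (Fin n) (Fin n) ℂ) (c : ℂ) (x y : Fin n → ℂ) :
    sesq B x (c • y) = c * sesq B x y := by
  simp [sesq, Matrix.mulVec_smul, dotProduct_smul]

theorem sesq_add_matrix (B C : Matrix (Fin n) (Fin n) ℂ) (x y : Fin n → ℂ) :
    sesq (B + C) x y = sesq B x y + sesq C x y := by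
  simp [sesq, Matrix.add_mulVec, dotProduct_add]

theorem sesq_smul_matrix (c : ℂ) (B : Matrix (Fin n) (Fin n) ℂ) (x y : Fin n → ℂ) :
    sesq (c • B) x y = c * sesq B x y := by
  simp [sesq, Matrix.smul_mulVec, dotProduct_smul]

theorem sesq_conj_symm {B : Matrix (Fin n) (Fin n) ℂ} (hB : B.IsHermitian) (x y : Fin n → ℂ) :
    sesq B y x = conj (sesq B x y) := by
  have h : star (star x ⬝ᵥ (B *ᵥ y)) = star y ⬝ᵥ (B *ᵥ x) := by
    rw [← Matrix.star_dotProduct_star, star_star, Matrix.star_mulVec, hB.eq,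
      dotProduct_comm, Matrix.dotProduct_mulVec, dotProduct_comm]
  exact h.symm

theorem form_add_matrix (B C : Matrix (Fin n) (Fin n) ℂ) (x : Fin n → ℂ) :
    form (B + C) x = form B x + form C x := by
  simp [form, sesq_add_matrix]

theorem form_smul_matrix (r : ℝ) (B : Matrix (Fin n) (Fin n) ℂ) (x : Fin n → ℂ) :
    form (r • B) x = r * form B x := by
  simp [form, sesq, Matrix.smul_mulVec, dotProduct_smul]

theorem form_neg_matrix (B : Matrix (Fin n) (Fin n) ℂ) (x : Fin n → ℂ) :
    form (-B) x = -form B x := by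
  simp [form, sesq, Matrix.neg_mulVec]

theorem form_sub_matrix (B C : Matrix (Fin n) (Fin n) ℂ) (x : Fin n → ℂ) :
    form (B - C) x = form B x - form C x := by
  rw [sub_eq_add_neg, form_add_matrix, form_neg_matrix, sub_eq_add_neg]

theorem form_zero_matrix (x : Fin n → ℂ) : form (0 : Matrix (Fin n) (Fin n) ℂ) x = 0 := by
  simp [form, sesq]

theorem form_zero (B : Matrix (Fin n) (Fin n) ℂ) : form B 0 = 0 := by
  simp [form, sesq]

theorem form_sum_matrix {ι : Type*} (s : Finset ι) (B : ι → Matrix (Fin n) (Fin n) ℂ)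
    (x : Fin n → ℂ) : form (∑ i ∈ s, B i) x = ∑ i ∈ s, form (B i) x := by
  induction s using Finset.cons_induction with
  | empty => simp [form_zero_matrix]
  | cons a s ha ih => rw [Finset.sum_cons, Finset.sum_cons, form_add_matrix, ih]

theorem form_smul (B : Matrix (Fin n) (Fin n) ℂ) (c : ℂ) (x : Fin n → ℂ) :
    form B (c • x) = ‖c‖ ^ 2 * form B x := by
  have h : sesq B (c • x) (c • x) = ((‖c‖ ^ 2 : ℝ) : ℂ) * sesq B x x := by
    rw [sesq_smul_left, sesq_smul_right, ← mul_assoc, Complex.conj_mul']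
    push_cast; rfl
  rw [form, h, Complex.re_ofReal_mul, form]

theorem form_smul_of_norm_eq_one (B : Matrix (Fin n) (Fin n) ℂ) {c : ℂ} (hc : ‖c‖ = 1)
    (x : Fin n → ℂ) : form B (c • x) = form B x := by
  rw [form_smul, hc, one_pow, one_mul]

theorem form_add {B : Matrix (Fin n) (Fin n) ℂ} (hB : B.IsHermitian) (x y : Fin n → ℂ) :
    form B (x + y) = form B x + form B y + 2 * (sesq B x y).re := by
  simp only [form, sesq_add_left, sesq_add_right, sesq_conj_symm hB x y, Complex.add_re,
    Complex.conj_re]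
  ring

theorem form_real_combination {B : Matrix (Fin n) (Fin n) ℂ} (hB : B.IsHermitian) (c s : ℝ)
    (x y : Fin n → ℂ) :
    form B ((c : ℂ) • x + (s : ℂ) • y) =
      c ^ 2 * form B x + s ^ 2 * form B y + 2 * c * s * (sesq B x y).re := by
  rw [form_add hB, form_smul, form_smul, sesq_smul_left, sesq_smul_right, Complex.conj_ofReal,
    Complex.re_ofReal_mul, Complex.re_ofReal_mul, Complex.norm_real, Complex.norm_real,
    Real.norm_eq_abs, Real.norm_eq_abs, sq_abs, sq_abs]
  ring

theorem form_one (x : Fin n → ℂ) : form 1 x = ∑ i, ‖x i‖ ^ 2 := by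
  simp only [form, sesq, Matrix.one_mulVec, dotProduct, Complex.re_sum, Pi.star_apply]
  refine Finset.sum_congr rfl fun i _ => ?_
  rw [RCLike.star_def, Complex.conj_mul']
  norm_cast

theorem form_one_pos {x : Fin n → ℂ} (hx : x ≠ 0) : 0 < form 1 x := by
  rw [form_one]
  obtain ⟨i, hi⟩ := Function.ne_iff.mp hx
  exact Finset.sum_pos' (fun i _ => by positivity)
    ⟨i, Finset.mem_univ i, by have := norm_pos_iff.mpr hi; positivity⟩

theorem continuous_sesq_right (B : Matrix (Fin n) (Fin n) ℂ) (x : Fin n → ℂ) :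
    Continuous (fun y => sesq B x y) := by
  unfold sesq
  exact continuous_const.dotProduct (continuous_const.matrix_mulVec continuous_id)

@[fun_prop]
theorem continuous_form (B : Matrix (Fin n) (Fin n) ℂ) : Continuous (form B) := by
  unfold form sesq
  exact Complex.continuous_re.comp
    (continuous_star.dotProduct (continuous_const.matrix_mulVec continuous_id))

theorem isHermitian_real_smul {B : Matrix (Fin n) (Fin n) ℂ} (hB : B.IsHermitian) (r : ℝ) :
    (r • B).IsHermitian := by
  rw [Matrix.IsHermitian, Matrix.conjTranspose_smul, hB.eq, star_trivial]

theorem posSemidef_of_form_nonneg {B : Matrix (Fin n) (Fin n) ℂ} (hB : B.IsHermitian)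
    (h : ∀ x, 0 ≤ form B x) : B.PosSemidef := by
  refine Matrix.PosSemidef.of_dotProduct_mulVec_nonneg hB fun x => ?_
  have h1 := coe_form hB x
  rw [sesq] at h1
  rw [← h1]
  exact_mod_cast h x

theorem form_nonneg_of_posSemidef {B : Matrix (Fin n) (Fin n) ℂ} (hB : B.PosSemidef)
    (x : Fin n → ℂ) : 0 ≤ form B x :=
  (Complex.le_def.mp (hB.dotProduct_mulVec_nonneg x)).1

theorem mem_null_iff_form_eq_zero {B : Matrix (Fin n) (Fin n) ℂ} (hB : B.PosSemidef)
    (x : Fin n → ℂ) : x ∈ null B ↔ form B x = 0 := by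
  have h1 : sesq B x x = 0 ↔ B *ᵥ x = 0 := hB.dotProduct_mulVec_zero_iff x
  rw [null, LinearMap.mem_ker, Matrix.mulVecLin_apply, ← h1, ← coe_form hB.isHermitian]
  exact Complex.ofReal_eq_zero

/-! ### Rotating pairs of vectors -/

theorem exists_unit_mul_re_eq_zero (p : ℂ) : ∃ e : ℂ, ‖e‖ = 1 ∧ (e * p).re = 0 := by
  by_cases hp : p = 0
  · exact ⟨1, by simp, by simp [hp]⟩
  · have hp' : (‖p‖ : ℂ) ≠ 0 := by simpa using hp
    refine ⟨Complex.I * (conj p / ‖p‖), by simp [hp], ?_⟩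
    have : Complex.I * (conj p / ‖p‖) * p = (‖p‖ : ℂ) * Complex.I := by
      field_simp
      rw [Complex.conj_mul']
    rw [this]; simp

/-- Two closed half-planes through the origin have a unit vector in common. -/
theorem exists_unit_mul_re_nonpos (p q : ℂ) :
    ∃ e : ℂ, ‖e‖ = 1 ∧ (e * p).re = 0 ∧ (e * q).re ≤ 0 := by
  obtain ⟨e, he, hp⟩ := exists_unit_mul_re_eq_zero p
  rcases le_total (e * q).re 0 with h | h
  · exact ⟨e, he, hp, h⟩
  · exact ⟨-e, by simpa using he, by rw [neg_mul, Complex.neg_re, hp, neg_zero],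
      by rw [neg_mul, Complex.neg_re]; linarith⟩

theorem exists_real_combination_form_eq_zero (H : Matrix (Fin n) (Fin n) ℂ)
    {x y : Fin n → ℂ} (hx : form H x < 0) (hy : 0 < form H y) :
    ∃ c s : ℝ, c ^ 2 + s ^ 2 = 1 ∧ form H ((c : ℂ) • x + (s : ℂ) • y) = 0 ∧
      (c : ℂ) • x + (s : ℂ) • y ≠ 0 := by
  have hcont : Continuous fun t : ℝ =>
      form H (((Real.cos t : ℝ) : ℂ) • x + ((Real.sin t : ℝ) : ℂ) • y) := by
    fun_prop
  obtain ⟨t, -, ht⟩ := intermediate_value_Icc (a := 0) (b := Real.pi / 2)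
    (by positivity) hcont.continuousOn
    (show (0 : ℝ) ∈ _ by constructor <;> simp [hx.le, hy.le])
  refine ⟨Real.cos t, Real.sin t, Real.cos_sq_add_sin_sq t, ht, fun h0 => ?_⟩
  -- a vanishing combination would make `c² H(x) = s² H(y)`, against the signs of `H(x)`, `H(y)`
  have h1 : ((Real.cos t : ℝ) : ℂ) • x = (-((Real.sin t : ℝ) : ℂ)) • y := by
    rw [neg_smul]; exact eq_neg_of_add_eq_zero_left h0
  have h2 := congrArg (form H) h1
  rw [form_smul, form_smul, norm_neg, Complex.norm_real, Complex.norm_real, Real.norm_eq_abs,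
    Real.norm_eq_abs, sq_abs, sq_abs] at h2
  have h3 := Real.cos_sq_add_sin_sq t
  have h4 := mul_nonneg (sq_nonneg (Real.cos t)) (neg_pos.mpr hx).le
  have h5 := mul_nonneg (sq_nonneg (Real.sin t)) hy.le
  have h6 : Real.cos t ^ 2 = 0 := by
    have : Real.cos t ^ 2 * form H x = 0 := by linarith
    exact (mul_eq_zero.mp this).resolve_right hx.ne
  have h7 : Real.sin t ^ 2 = 0 := by
    have : Real.sin t ^ 2 * form H y = 0 := by linarith
    exact (mul_eq_zero.mp this).resolve_right hy.ne'
  linarith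

/-- A pair `x, y` isotropic for `C` with `D(x) < 0 < D(y)` can be replaced by a unitary mixture
`x', y'` that is still isotropic for `C`, with `D(x') = 0`. The matrix `x xᴴ + y yᴴ`, and with it
the sum of the values of every Hermitian form, stays the same. -/
theorem exists_unitary_mixture {C D : Matrix (Fin n) (Fin n) ℂ} (hC : C.IsHermitian)
    (V : Submodule ℂ (Fin n → ℂ)) {x y : Fin n → ℂ}
    (hxV : x ∈ V) (hyV : y ∈ V) (hCx : form C x = 0) (hCy : form C y = 0)
    (hDx : form D x < 0) (hDy : 0 < form D y) :
    ∃ x' ∈ V, ∃ y' ∈ V, form C x' = 0 ∧ form C y' = 0 ∧ form D x' = 0 ∧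
      ∀ H : Matrix (Fin n) (Fin n) ℂ, H.IsHermitian →
        form H x' + form H y' = form H x + form H y := by
  -- after this rotation of `y` every real combination of `x` and `y` is isotropic for `C`
  obtain ⟨e, he, hre⟩ := exists_unit_mul_re_eq_zero (sesq C x y)
  have hf (H : Matrix (Fin n) (Fin n) ℂ) : form H (e • y) = form H y :=
    form_smul_of_norm_eq_one H he y
  have hre' : (sesq C x (e • y)).re = 0 := by rwa [sesq_smul_right]
  obtain ⟨c, s, hcs, h0, -⟩ := exists_real_combination_form_eq_zero D hDx
    (show 0 < form D (e • y) by rwa [hf])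
  refine ⟨_, V.add_mem (V.smul_mem c hxV) (V.smul_mem s (V.smul_mem e hyV)),
    ((-s : ℝ) : ℂ) • x + (c : ℂ) • (e • y),
    V.add_mem (V.smul_mem _ hxV) (V.smul_mem c (V.smul_mem e hyV)), ?_, ?_, h0, ?_⟩
  · rw [form_real_combination hC, hre', hf, hCx, hCy]; ring
  · rw [form_real_combination hC, hre', hf, hCx, hCy]; ring
  · intro H hH
    rw [form_real_combination hH, form_real_combination hH, hf]
    linear_combination (form H x + form H y) * hcs

/-! ### Rank-one decompositions -/

/-- The sum of the values of the form `H` over a finite multiset of vectors `y`; this is the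
trace of `H X` for the positive semidefinite matrix `X = ∑ y yᴴ`. -/
def formSum (s : Multiset (Fin n → ℂ)) (H : Matrix (Fin n) (Fin n) ℂ) : ℝ :=
  (s.map (form H)).sum

theorem formSum_zero (H : Matrix (Fin n) (Fin n) ℂ) : formSum 0 H = 0 := by
  simp [formSum]

theorem formSum_cons (y : Fin n → ℂ) (s : Multiset (Fin n → ℂ)) (H : Matrix (Fin n) (Fin n) ℂ) :
    formSum (y ::ₘ s) H = form H y + formSum s H := by
  simp [formSum]

theorem formSum_add (s t : Multiset (Fin n → ℂ)) (H : Matrix (Fin n) (Fin n) ℂ) :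
    formSum (s + t) H = formSum s H + formSum t H := by
  simp [formSum]

theorem formSum_add_matrix (s : Multiset (Fin n → ℂ)) (H K : Matrix (Fin n) (Fin n) ℂ) :
    formSum s (H + K) = formSum s H + formSum s K := by
  induction s using Multiset.induction_on with
  | empty => simp [formSum_zero]
  | cons y s ih => rw [formSum_cons, formSum_cons, formSum_cons, ih, form_add_matrix]; ring

theorem formSum_smul_matrix (s : Multiset (Fin n → ℂ)) (r : ℝ) (H : Matrix (Fin n) (Fin n) ℂ) :
    formSum s (r • H) = r * formSum s H := by
  induction s using Multiset.induction_on with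
  | empty => simp [formSum_zero]
  | cons y s ih => rw [formSum_cons, formSum_cons, ih, form_smul_matrix]; ring

theorem formSum_neg_matrix (s : Multiset (Fin n → ℂ)) (H : Matrix (Fin n) (Fin n) ℂ) :
    formSum s (-H) = -formSum s H := by
  have h := formSum_smul_matrix s (-1) H
  rwa [neg_one_smul, neg_one_mul] at h

theorem formSum_sub_matrix (s : Multiset (Fin n → ℂ)) (H K : Matrix (Fin n) (Fin n) ℂ) :
    formSum s (H - K) = formSum s H - formSum s K := by
  rw [sub_eq_add_neg, formSum_add_matrix, formSum_neg_matrix, sub_eq_add_neg]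

theorem exists_form_neg_of_formSum_neg {s : Multiset (Fin n → ℂ)}
    {H : Matrix (Fin n) (Fin n) ℂ} (h : formSum s H < 0) : ∃ y ∈ s, form H y < 0 := by
  by_contra! hc
  refine absurd h (not_lt.mpr (Multiset.sum_nonneg fun r hr => ?_))
  obtain ⟨y, hy, rfl⟩ := Multiset.mem_map.mp hr
  exact hc y hy

theorem form_eq_zero_of_formSum_eq_zero {s : Multiset (Fin n → ℂ)}
    {H : Matrix (Fin n) (Fin n) ℂ} (h : formSum s H = 0) (hpos : ∀ y ∈ s, 0 ≤ form H y) :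
    ∀ y ∈ s, form H y = 0 := by
  induction s using Multiset.induction_on with
  | empty => simp
  | cons a s ih =>
    rw [formSum_cons] at h
    have ha := hpos a (Multiset.mem_cons_self a s)
    have hs : 0 ≤ formSum s H := Multiset.sum_nonneg fun r hr => by
      obtain ⟨y, hy, rfl⟩ := Multiset.mem_map.mp hr
      exact hpos y (Multiset.mem_cons_of_mem hy)
    intro y hy
    rcases Multiset.mem_cons.mp hy with rfl | hy
    · linarith
    · exact ih (by linarith) (fun z hz => hpos z (Multiset.mem_cons_of_mem hz)) y hy

/-- If the sum is not zero term by term, it has terms of both signs. -/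
theorem exists_neg_pos_of_formSum_eq_zero {s : Multiset (Fin n → ℂ)}
    {H : Matrix (Fin n) (Fin n) ℂ} (h : formSum s H = 0) (hne : ∃ y ∈ s, form H y ≠ 0) :
    (∃ y ∈ s, form H y < 0) ∧ ∃ y ∈ s, 0 < form H y := by
  obtain ⟨y, hy, hy0⟩ := hne
  constructor
  · by_contra! hc
    exact hy0 (form_eq_zero_of_formSum_eq_zero h hc y hy)
  · by_contra! hc
    have h' : formSum s (-H) = 0 := by rw [formSum_neg_matrix, h, neg_zero]
    have := form_eq_zero_of_formSum_eq_zero h'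
      (fun z hz => by rw [form_neg_matrix]; linarith [hc z hz]) y hy
    rw [form_neg_matrix] at this
    exact hy0 (by linarith)

/-- The inductive step of the rank-one decomposition: mix a vector with `D < 0` and one with
`D > 0`, put the resulting `D`-isotropic vector aside, and go on with the rest. -/
theorem exists_decomposition_step {C D : Matrix (Fin n) (Fin n) ℂ} (hC : C.IsHermitian)
    (hD : D.IsHermitian) (V : Submodule ℂ (Fin n → ℂ)) (s : Multiset (Fin n → ℂ))
    (hV : ∀ y ∈ s, y ∈ V) (hsC : ∀ y ∈ s, form C y = 0) (hsD : formSum s D = 0) :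
    ∃ t : Multiset (Fin n → ℂ), (∀ y ∈ t, y ∈ V ∧ form C y = 0 ∧ form D y = 0) ∧
      ∀ H : Matrix (Fin n) (Fin n) ℂ, H.IsHermitian → formSum t H = formSum s H := by
  induction hN : s.card generalizing s with
  | zero =>
    obtain rfl := Multiset.card_eq_zero.mp hN
    exact ⟨0, by simp, fun _ _ => rfl⟩
  | succ N ih =>
    by_cases hall : ∀ y ∈ s, form D y = 0
    · exact ⟨s, fun y hy => ⟨hV y hy, hsC y hy, hall y hy⟩, fun _ _ => rfl⟩
    push Not at hall
    obtain ⟨⟨x, hx, hDx⟩, y, hy, hDy⟩ := exists_neg_pos_of_formSum_eq_zero hsD hall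
    obtain ⟨s₁, rfl⟩ := Multiset.exists_cons_of_mem hx
    have hy₁ : y ∈ s₁ := by
      rcases Multiset.mem_cons.mp hy with rfl | h
      · exact absurd hDy hDx.not_gt
      · exact h
    obtain ⟨s₂, rfl⟩ := Multiset.exists_cons_of_mem hy₁
    obtain ⟨x', hx'V, y', hy'V, hCx', hCy', hDx', hsum⟩ := exists_unitary_mixture hC V
      (hV x hx) (hV y hy) (hsC x hx) (hsC y hy) hDx hDy
    have hmem {z : Fin n → ℂ} (hz : z ∈ s₂) : z ∈ x ::ₘ y ::ₘ s₂ :=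
      Multiset.mem_cons_of_mem (Multiset.mem_cons_of_mem hz)
    obtain ⟨t, ht, htsum⟩ := ih (y' ::ₘ s₂)
      (fun z hz => by
        rcases Multiset.mem_cons.mp hz with rfl | hz
        exacts [hy'V, hV z (hmem hz)])
      (fun z hz => by
        rcases Multiset.mem_cons.mp hz with rfl | hz
        exacts [hCy', hsC z (hmem hz)])
      (by
        have := hsum D hD
        rw [formSum_cons, formSum_cons] at hsD
        rw [formSum_cons]; linarith)
      (by simpa using hN)
    refine ⟨x' ::ₘ t, fun z hz => ?_, fun H hH => ?_⟩
    · rcases Multiset.mem_cons.mp hz with rfl | hz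
      exacts [⟨hx'V, hCx', hDx'⟩, ht z hz]
    · have := hsum H hH
      rw [formSum_cons, formSum_cons, formSum_cons, htsum H hH, formSum_cons]
      linarith

/-- Rank-one decomposition: if `tr(C X) = tr(D X) = 0` for a sum `X` of rank-one matrices
`y yᴴ`, then `X` is also such a sum with all `y` isotropic for both `C` and `D`. -/
theorem exists_rank_one_decomposition {C D : Matrix (Fin n) (Fin n) ℂ} (hC : C.IsHermitian)
    (hD : D.IsHermitian) (V : Submodule ℂ (Fin n → ℂ)) (s : Multiset (Fin n → ℂ))
    (hV : ∀ y ∈ s, y ∈ V) (hsC : formSum s C = 0) (hsD : formSum s D = 0) :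
    ∃ t : Multiset (Fin n → ℂ), (∀ y ∈ t, y ∈ V ∧ form C y = 0 ∧ form D y = 0) ∧
      ∀ H : Matrix (Fin n) (Fin n) ℂ, H.IsHermitian → formSum t H = formSum s H := by
  obtain ⟨s₁, hs₁, hsum₁⟩ := exists_decomposition_step Matrix.isHermitian_zero hC V s hV
    (fun y _ => form_zero_matrix y) hsC
  obtain ⟨t, ht, hsum⟩ := exists_decomposition_step hC hD V s₁ (fun y hy => (hs₁ y hy).1)
    (fun y hy => (hs₁ y hy).2.2) ((hsum₁ D hD).trans hsD)
  exact ⟨t, ht, fun H hH => (hsum H hH).trans (hsum₁ H hH)⟩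

/-! ### A common zero of three forms on a three-dimensional space -/

/-- A parametrization, by the difference `t = y - r`, of the branch `r y = k`, `r, y ≥ 0` of a
hyperbola. For `k = 0` it runs down the half-line `y = 0` and up the half-line `r = 0`. -/
theorem exists_hyperbola_parametrization {k : ℝ} (hk : 0 ≤ k) :
    ∃ r y : ℝ → ℝ, Continuous r ∧ Continuous y ∧
      (∀ t, 0 ≤ r t ∧ 0 ≤ y t ∧ r t * y t = k) ∧
      (∀ t ≤ 0, y t ≤ k + 1 ∧ -t ≤ r t) ∧ (∀ t, 0 ≤ t → r t ≤ k + 1 ∧ t ≤ y t) := by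
  have hsq (t : ℝ) : √(t ^ 2 + 4 * k) ^ 2 = t ^ 2 + 4 * k := Real.sq_sqrt (by positivity)
  have habs (t : ℝ) : |t| ≤ √(t ^ 2 + 4 * k) := Real.abs_le_sqrt (by linarith)
  have hmain (t : ℝ) : 0 ≤ (√(t ^ 2 + 4 * k) - t) / 2 ∧ 0 ≤ (√(t ^ 2 + 4 * k) + t) / 2 ∧
      (√(t ^ 2 + 4 * k) - t) / 2 * ((√(t ^ 2 + 4 * k) + t) / 2) = k := by
    have h1 := abs_le.mp (habs t)
    refine ⟨by linarith, by linarith, ?_⟩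
    linear_combination hsq t / 4
  refine ⟨fun t => (√(t ^ 2 + 4 * k) - t) / 2, fun t => (√(t ^ 2 + 4 * k) + t) / 2,
    by fun_prop, by fun_prop, hmain, fun t ht => ?_, fun t ht => ?_⟩
  · obtain ⟨h1, h2, h3⟩ := hmain t
    refine ⟨?_, by linarith⟩
    by_contra! hc
    nlinarith
  · obtain ⟨h1, h2, h3⟩ := hmain t
    refine ⟨?_, by linarith⟩
    by_contra! hc
    nlinarith

theorem exists_unit_of_ne_zero {b : ℂ} (hb : b ≠ 0) : ∃ β : ℂ, ‖β‖ = 1 ∧ b = ‖b‖ * β :=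
  ⟨b / ‖b‖, by simp [hb], by
    have : (‖b‖ : ℂ) ≠ 0 := by simpa using hb
    field_simp⟩

/-- A curve on the real surface `ū v + b v̄ + c u + e = 0` in `ℂ²`, parametrized by the points
`(r, y)` of a branch of a hyperbola. It leads from `|u| = ∞` with `v` bounded to `|v| = ∞` with `u`
bounded. For fixed `u` the equation is real linear in `v` and singular exactly for `|u| = |b|`;
`u` moves on a ray, whose direction is chosen to diagonalize the equation. -/
theorem exists_curve_on_surface (b c e : ℂ) :
    ∃ (ω η : ℂ) (β k : ℝ) (v₀ : ℝ → ℂ) (M : ℝ), ‖ω‖ = 1 ∧ ‖η‖ = 1 ∧ 0 ≤ β ∧ 0 ≤ k ∧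
      ContinuousOn v₀ (Set.Ici 0) ∧ (∀ r, 0 ≤ r → ‖v₀ r‖ ≤ M) ∧
      ∀ r y : ℝ, 0 ≤ r → r * y = k →
        conj (((r + β : ℝ) : ℂ) * ω) * (v₀ r + y * η) + b * conj (v₀ r + y * η) +
          c * (((r + β : ℝ) : ℂ) * ω) + e = 0 := by
  by_cases hb : b = 0
  · -- here the equation is `r (v + c) = -e` for `u = r ≥ 0`
    have hη : ∃ η : ℂ, ‖η‖ = 1 ∧ -e = ‖e‖ * η := by
      by_cases he : e = 0
      · exact ⟨1, by simp, by simp [he]⟩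
      · simpa using exists_unit_of_ne_zero (neg_ne_zero.mpr he)
    obtain ⟨η, hη, hη'⟩ := hη
    refine ⟨1, η, 0, ‖e‖, fun _ => -c, ‖c‖, by simp, hη, le_rfl, norm_nonneg _,
      continuousOn_const, fun r _ => by simp, fun r y _ hry => ?_⟩
    have hry' : (r : ℂ) * y = ‖e‖ := by exact_mod_cast hry
    simp only [hb, add_zero, mul_one, Complex.conj_ofReal]
    linear_combination η * hry' - hη'
  · obtain ⟨β, hβ, hbβ⟩ := exists_unit_of_ne_zero hb
    have hbpos : 0 < ‖b‖ := norm_pos_iff.mpr hb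
    have hββ : β * conj β = 1 := by rw [Complex.mul_conj', hβ]; simp
    -- a cube root of the inverse phase of `c β⁻²`, up to sign
    have hz : ∃ z : ℂ, ‖z‖ = 1 ∧ (c * z ^ 3 * conj β ^ 2).im = 0 ∧ (z * conj β * e).im ≤ 0 := by
      have h1 : ∃ z : ℂ, ‖z‖ = 1 ∧ (c * z ^ 3 * conj β ^ 2).im = 0 := by
        by_cases hc : c = 0
        · exact ⟨1, by simp, by simp [hc]⟩
        · have hβ0 : conj β ≠ 0 := by
            intro h; rw [h, mul_zero] at hββ; exact zero_ne_one hββ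
          obtain ⟨γ, hγ, hcγ⟩ := exists_unit_of_ne_zero
            (mul_ne_zero hc (pow_ne_zero 2 hβ0))
          obtain ⟨z, hz⟩ := IsAlgClosed.exists_pow_nat_eq (conj γ) (n := 3) (by norm_num)
          refine ⟨z, ?_, ?_⟩
          · have := congrArg norm hz
            rw [norm_pow, Complex.norm_conj, hγ] at this
            exact (pow_eq_one_iff_of_nonneg (norm_nonneg z) (by norm_num)).mp this
          · have h2 : c * z ^ 3 * conj β ^ 2 = ((‖c * conj β ^ 2‖ : ℝ) : ℂ) := by
              have h3 : γ * conj γ = 1 := by rw [Complex.mul_conj', hγ]; simp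
              rw [hz]
              linear_combination (conj γ) * hcγ + (‖c * conj β ^ 2‖ : ℂ) * h3
            rw [h2, Complex.ofReal_im]
      obtain ⟨z, hz, hcz⟩ := h1
      rcases le_total (z * conj β * e).im 0 with h | h
      · exact ⟨z, hz, hcz, h⟩
      · refine ⟨-z, by simpa using hz, ?_, ?_⟩
        · have : c * (-z) ^ 3 * conj β ^ 2 = -(c * z ^ 3 * conj β ^ 2) := by ring
          rw [this, Complex.neg_im, hcz, neg_zero]
        · have : -z * conj β * e = -(z * conj β * e) := by ring
          rw [this, Complex.neg_im]; linarith
    obtain ⟨z, hz, hcz, hez⟩ := hz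
    have hzz : z * conj z = 1 := by rw [Complex.mul_conj', hz]; simp
    set C : ℝ := (c * z ^ 3 * conj β ^ 2).re with hC
    set E : ℝ := (z * conj β * e).re with hE
    set k : ℝ := -(z * conj β * e).im with hk
    have hC' : c * z ^ 3 * conj β ^ 2 = C := Complex.ext (by simp [hC]) (by simp [hcz])
    have hE' : z * conj β * e = E - k * Complex.I := by
      apply Complex.ext <;> simp [hE, hk]
    have hden (r : ℝ) (hr : 0 ≤ r) : 0 < r + 2 * ‖b‖ := by positivity
    refine ⟨z ^ 2 * conj β, z * Complex.I, ‖b‖, k,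
      fun r => z * ((-(C * (r + ‖b‖) + E) / (r + 2 * ‖b‖) : ℝ) : ℂ), |C| + |E| / (2 * ‖b‖),
      by simp [hz, hβ], by simp [hz], hbpos.le, by linarith, ?_, fun r hr => ?_,
      fun r y hr hry => ?_⟩
    · refine continuousOn_const.mul (Complex.continuous_ofReal.comp_continuousOn ?_)
      exact ContinuousOn.div (by fun_prop) (by fun_prop) fun r hr => (hden r hr).ne'
    · rw [norm_mul, hz, one_mul, Complex.norm_real, Real.norm_eq_abs, abs_div, abs_neg,
        abs_of_pos (hden r hr), div_le_iff₀ (hden r hr)]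
      have h1 : |C * (r + ‖b‖) + E| ≤ |C| * (r + ‖b‖) + |E| := by
        refine (abs_add_le _ _).trans ?_
        rw [abs_mul, abs_of_nonneg (add_nonneg hr hbpos.le)]
      have h2 : (|C| + |E| / (2 * ‖b‖)) * (r + 2 * ‖b‖) =
          |C| * (r + ‖b‖) + |E| + (|C| * ‖b‖ + |E| / (2 * ‖b‖) * r) := by
        field_simp; ring
      have h3 : 0 ≤ |C| * ‖b‖ + |E| / (2 * ‖b‖) * r := by positivity
      linarith
    · set y₁ : ℝ := -(C * (r + ‖b‖) + E) / (r + 2 * ‖b‖) with hy₁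
      have h1 : (r + 2 * ‖b‖) * y₁ = -(C * (r + ‖b‖) + E) := by
        rw [hy₁]; field_simp [(hden r hr).ne']
      have h1' : ((r : ℂ) + 2 * ‖b‖) * y₁ = -(C * (r + ‖b‖) + E) := by exact_mod_cast h1
      have hry' : (r : ℂ) * y = k := by exact_mod_cast hry
      simp only [map_mul, map_add, map_pow, Complex.conj_conj, Complex.conj_ofReal,
        Complex.conj_I, Complex.ofReal_add]
      -- the left side is `β z̄` times `(r + 2|b|) y₁ + i r y + C (r + |b|) + (E - i k)`
      have key : β * conj z * (((r : ℂ) + 2 * ‖b‖) * y₁ + r * y * Complex.I +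
          c * z ^ 3 * conj β ^ 2 * (r + ‖b‖) + z * conj β * e) = 0 := by
        rw [h1', hry', hC', hE']; ring
      linear_combination key +
        ((r + ‖b‖) * β * conj z * (y₁ + y * Complex.I) -
          (c * z ^ 2 * conj β * (r + ‖b‖) + e) * β * conj β) * hzz -
        (c * z ^ 2 * conj β * (r + ‖b‖) + e) * hββ +
        conj z * (y₁ - y * Complex.I) * hbβ

theorem exists_zero_on_surface {g : ℂ × ℂ → ℝ} (hg : Continuous g)
    (hneg : ∀ M : ℝ, ∃ R : ℝ, ∀ u v : ℂ, ‖v‖ ≤ M → R ≤ ‖u‖ → g (u, v) < 0)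
    (hpos : ∀ M : ℝ, ∃ R : ℝ, ∀ u v : ℂ, ‖u‖ ≤ M → R ≤ ‖v‖ → 0 < g (u, v)) (b c e : ℂ) :
    ∃ u v : ℂ, conj u * v + b * conj v + c * u + e = 0 ∧ g (u, v) = 0 := by
  obtain ⟨ω, η, β, k, v₀, M, hω, hη, hβ, hk, hv₀, hM, hsurf⟩ := exists_curve_on_surface b c e
  obtain ⟨r, y, hrc, hyc, hry, hleft, hright⟩ := exists_hyperbola_parametrization hk
  set γ : ℝ → ℂ × ℂ := fun t => (((r t + β : ℝ) : ℂ) * ω, v₀ (r t) + y t * η) with hγ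
  have hγc : Continuous γ := by
    have h1 : Continuous fun t => v₀ (r t) := hv₀.comp_continuous hrc fun t => (hry t).1
    exact Continuous.prodMk
      ((Complex.continuous_ofReal.comp (hrc.add continuous_const)).mul continuous_const)
      (h1.add ((Complex.continuous_ofReal.comp hyc).mul continuous_const))
  have hnorm₁ (t : ℝ) : ‖(γ t).1‖ = r t + β := by
    rw [hγ, norm_mul, hω, mul_one, Complex.norm_real, Real.norm_eq_abs,
      abs_of_nonneg (add_nonneg (hry t).1 hβ)]
  have hnormy (t : ℝ) : ‖(y t : ℂ) * η‖ = y t := by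
    rw [norm_mul, hη, mul_one, Complex.norm_real, Real.norm_eq_abs, abs_of_nonneg (hry t).2.1]
  obtain ⟨R₁, hR₁⟩ := hneg (M + (k + 1))
  obtain ⟨R₂, hR₂⟩ := hpos (k + 1 + β)
  have h₁ : g (γ (-|R₁|)) < 0 := by
    obtain ⟨h1, h2⟩ := hleft (-|R₁|) (by simp)
    refine hR₁ _ _ ?_ ?_
    · refine (norm_add_le _ _).trans ?_
      rw [hnormy]
      exact add_le_add (hM _ (hry _).1) h1
    · have := hnorm₁ (-|R₁|)
      simp only [hγ] at this
      rw [this]; linarith [le_abs_self R₁]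
  have h₂ : 0 < g (γ (|R₂| + |M|)) := by
    obtain ⟨h1, h2⟩ := hright (|R₂| + |M|) (by positivity)
    refine hR₂ _ _ ?_ ?_
    · have := hnorm₁ (|R₂| + |M|)
      simp only [hγ] at this
      rw [this]; linarith
    · have h3 := norm_sub_le_norm_add ((y (|R₂| + |M|) : ℂ) * η) (v₀ (r (|R₂| + |M|)))
      rw [hnormy, add_comm ((y (|R₂| + |M|) : ℂ) * η)] at h3
      have h4 := hM _ (hry (|R₂| + |M|)).1
      linarith [le_abs_self R₂, le_abs_self M]
  obtain ⟨t, ht⟩ := mem_range_of_exists_le_of_exists_ge (hg.comp hγc) ⟨_, h₁.le⟩ ⟨_, h₂.le⟩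
  exact ⟨_, _, hsurf (r t) (y t) (hry t).1 (hry t).2.2, ht⟩

/-- Where `G(x) < 0`, the term `|u|² G(x)` dominates in `G(u x + v y + w)`. -/
theorem exists_bound_form_neg {G : Matrix (Fin n) (Fin n) ℂ} (hG : G.IsHermitian)
    {x : Fin n → ℂ} (hx : form G x < 0) (y w : Fin n → ℂ) (M : ℝ) :
    ∃ R : ℝ, ∀ u v : ℂ, ‖v‖ ≤ M → R ≤ ‖u‖ → form G (u • x + v • y + w) < 0 := by
  have hcpt := isCompact_closedBall (0 : ℂ) M
  obtain ⟨K₁, hK₁⟩ := hcpt.exists_bound_of_continuousOn (f := fun v => sesq G x (v • y + w))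
    ((continuous_sesq_right G x).comp (by fun_prop)).continuousOn
  obtain ⟨K₂, hK₂⟩ := hcpt.exists_bound_of_continuousOn (f := fun v => form G (v • y + w))
    (by fun_prop)
  set K : ℝ := |K₁| + |K₂| with hK
  have hK0 : 0 ≤ K := by positivity
  refine ⟨3 * K / (-form G x) + 1, fun u v hv hu => ?_⟩
  have hv' : v ∈ Metric.closedBall (0 : ℂ) M := by simpa using hv
  have h1 : (conj u * sesq G x (v • y + w)).re ≤ ‖u‖ * K := by
    refine (Complex.re_le_norm _).trans ?_
    rw [norm_mul, Complex.norm_conj]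
    gcongr
    linarith [hK₁ v hv', le_abs_self K₁, abs_nonneg K₂]
  have h2 : form G (v • y + w) ≤ K := by
    have := hK₂ v hv'
    rw [Real.norm_eq_abs] at this
    linarith [le_abs_self (form G (v • y + w)), le_abs_self K₂, abs_nonneg K₁]
  have hx' : 0 < -form G x := by linarith
  have h3 : 0 ≤ 3 * K / (-form G x) := by positivity
  have h4 : 3 * K < ‖u‖ * (-form G x) := by
    rw [← div_lt_iff₀ hx']; linarith
  rw [add_assoc, form_add hG, form_smul, sesq_smul_left]
  have h5 : 1 ≤ ‖u‖ := by linarith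
  nlinarith

/-- The Hermitian form `G` changes sign on the zero set of the complex form `F` in a
three-dimensional space, provided that `F` restricts to a nilpotent Jordan block on a plane with
basis `x₁, x₂` and `G(x₁) < 0 < G(x₂)`. On the plane alone the zeros of `F` are just the
multiples of `x₁` and of `x₂`; the third dimension connects them. -/
theorem exists_common_zero_of_jordan_block {F G : Matrix (Fin n) (Fin n) ℂ}
    (hG : G.IsHermitian) {x₁ x₂ w : Fin n → ℂ} (h11 : sesq F x₁ x₁ = 0) (h22 : sesq F x₂ x₂ = 0)
    (h21 : sesq F x₂ x₁ = 0) (h12 : sesq F x₁ x₂ = 1) (hG₁ : form G x₁ < 0)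
    (hG₂ : 0 < form G x₂) :
    ∃ a b : ℂ, sesq F (w + (a • x₁ + b • x₂)) (w + (a • x₁ + b • x₂)) = 0 ∧
      form G (w + (a • x₁ + b • x₂)) = 0 := by
  -- shift `w` to make `F(x₁, w') = F(w', x₂) = 0`
  obtain ⟨w', hw'⟩ : ∃ w', w' = w - conj (sesq F w x₂) • x₁ - sesq F x₁ w • x₂ := ⟨_, rfl⟩
  have hw : w = w' + conj (sesq F w x₂) • x₁ + sesq F x₁ w • x₂ := by rw [hw']; module
  have e1 : sesq F x₁ w' = 0 := by
    have := congrArg (sesq F x₁) hw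
    simp only [sesq_add_right, sesq_smul_right, h11, h12] at this
    linear_combination -this
  have e2 : sesq F w' x₂ = 0 := by
    have := congrArg (fun z => sesq F z x₂) hw
    simp only [sesq_add_left, sesq_smul_left, h12, h22, Complex.conj_conj] at this
    linear_combination -this
  obtain ⟨u, v, huv, hg⟩ := exists_zero_on_surface
    (g := fun p => form G (p.1 • x₁ + p.2 • x₂ + w')) (by fun_prop)
    (fun M => exists_bound_form_neg hG hG₁ x₂ w' M)
    (fun M => by
      obtain ⟨R, hR⟩ := exists_bound_form_neg hG.neg
        (show form (-G) x₂ < 0 by rw [form_neg_matrix]; linarith) x₁ w' M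
      refine ⟨R, fun u v hu hv => ?_⟩
      have := hR v u hu hv
      rw [form_neg_matrix, add_comm (v • x₂)] at this
      linarith)
    (sesq F x₂ w') (sesq F w' x₁) (sesq F w' w')
  have hz : w + ((u - conj (sesq F w x₂)) • x₁ + (v - sesq F x₁ w) • x₂) =
      u • x₁ + v • x₂ + w' := by rw [hw']; module
  refine ⟨u - conj (sesq F w x₂), v - sesq F x₁ w, ?_, ?_⟩
  · rw [hz]
    simp only [sesq_add_left, sesq_add_right, sesq_smul_left, sesq_smul_right, h11, h12, h21, h22,
      e1, e2]
    linear_combination huv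
  · rw [hz]; exact hg

theorem eq_zero_of_conj_combination_eq_zero {p q : ℂ} (h : (p * conj q).im ≠ 0) {s t : ℝ}
    (hst : conj q * s - conj p * t = 0) : s = 0 ∧ t = 0 := by
  have h1 := congrArg Complex.re hst
  have h2 := congrArg Complex.im hst
  simp at h1 h2 h
  have hs : (p.re * -q.im + p.im * q.re) * s = 0 := by linear_combination p.im * h1 + p.re * h2
  have ht : (p.re * -q.im + p.im * q.re) * t = 0 := by linear_combination q.im * h1 + q.re * h2
  have h' : p.re * -q.im + p.im * q.re ≠ 0 := fun h0 => h (by linarith)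
  exact ⟨(mul_eq_zero.mp hs).resolve_left h', (mul_eq_zero.mp ht).resolve_left h'⟩

/-- Two Hermitian forms that are isotropic at `x₁, x₂` and whose off-diagonal values
`p = B(x₁, x₂)` and `q = C(x₁, x₂)` are linearly independent over `ℝ` have a complex combination
that restricts to a Jordan block on the plane; being complex, it still determines both. -/
theorem exists_common_zero_of_isotropic_pair {B C G : Matrix (Fin n) (Fin n) ℂ}
    (hB : B.IsHermitian) (hC : C.IsHermitian) (hG : G.IsHermitian) {x₁ x₂ w : Fin n → ℂ}
    (hB₁ : form B x₁ = 0) (hB₂ : form B x₂ = 0) (hC₁ : form C x₁ = 0) (hC₂ : form C x₂ = 0)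
    (hpq : (sesq B x₁ x₂ * conj (sesq C x₁ x₂)).im ≠ 0) (hG₁ : form G x₁ < 0)
    (hG₂ : 0 < form G x₂) :
    ∃ a b : ℂ, form B (w + (a • x₁ + b • x₂)) = 0 ∧ form C (w + (a • x₁ + b • x₂)) = 0 ∧
      form G (w + (a • x₁ + b • x₂)) = 0 := by
  set p := sesq B x₁ x₂ with hp
  set q := sesq C x₁ x₂ with hq
  set d : ℂ := conj q * p - conj p * q with hd
  have hd0 : d ≠ 0 := by
    intro h0
    have h1 := congrArg Complex.im h0
    apply hpq
    simp [hd] at h1 ⊢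
    linarith
  set F : Matrix (Fin n) (Fin n) ℂ := d⁻¹ • (conj q • B + (-conj p) • C) with hF
  have hFs (x y : Fin n → ℂ) : sesq F x y = d⁻¹ * (conj q * sesq B x y - conj p * sesq C x y) := by
    rw [hF, sesq_smul_matrix, sesq_add_matrix, sesq_smul_matrix, sesq_smul_matrix]; ring
  have hFf (x : Fin n → ℂ) : sesq F x x = d⁻¹ * (conj q * form B x - conj p * form C x) := by
    rw [hFs, coe_form hB, coe_form hC]
  obtain ⟨a, b, h1, h2⟩ := exists_common_zero_of_jordan_block (F := F) (w := w) hG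
    (by simp [hFf, hB₁, hC₁]) (by simp [hFf, hB₂, hC₂])
    (by rw [hFs, sesq_conj_symm hB x₁ x₂, sesq_conj_symm hC x₁ x₂, ← hp, ← hq]; ring)
    (by rw [hFs, ← hp, ← hq, ← hd, inv_mul_cancel₀ hd0]) hG₁ hG₂
  rw [hFf] at h1
  have h3 := (mul_eq_zero.mp h1).resolve_left (inv_ne_zero hd0)
  obtain ⟨h4, h5⟩ := eq_zero_of_conj_combination_eq_zero hpq h3
  exact ⟨a, b, h4, h5, h2⟩

/-! ### Perturbation to a strictly negative vector -/

theorem exists_form_neg_pair {B C : Matrix (Fin n) (Fin n) ℂ} (hB : B.IsHermitian)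
    (hC : C.IsHermitian) {s : Multiset (Fin n → ℂ)} (hsB : formSum s B < 0)
    (hsC : formSum s C < 0) : ∃ h, form B h < 0 ∧ form C h < 0 := by
  set r := formSum s B / formSum s C with hr
  have hr0 : 0 < r := div_pos_of_neg_of_neg hsB hsC
  have h0 : formSum s (B - r • C) = 0 := by
    rw [formSum_sub_matrix, formSum_smul_matrix, hr, div_mul_cancel₀ _ hsC.ne, sub_self]
  obtain ⟨t, ht, htsum⟩ := exists_rank_one_decomposition Matrix.isHermitian_zero
    (hB.sub (isHermitian_real_smul hC r)) ⊤ s (fun _ _ => trivial)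
    (by simp [formSum, form_zero_matrix]) h0
  obtain ⟨y, hy, hyC⟩ := exists_form_neg_of_formSum_neg ((htsum C hC).trans_lt hsC)
  have h1 := (ht y hy).2.2
  rw [form_sub_matrix, form_smul_matrix] at h1
  exact ⟨y, by nlinarith, hyC⟩

/-- At most two of the four inequalities at `x` are not strict; moving in a direction `h` at which
these two forms are negative, with a phase that makes their first-order terms nonpositive,
makes all of them strict. -/
theorem exists_all_form_neg {B₀ B₁ B₂ B₃ : Matrix (Fin n) (Fin n) ℂ}
    (hB₂ : B₂.IsHermitian) (hB₃ : B₃.IsHermitian) {x h : Fin n → ℂ}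
    (hx₀ : form B₀ x < 0) (hx₁ : form B₁ x < 0) (hx₂ : form B₂ x ≤ 0) (hx₃ : form B₃ x ≤ 0)
    (hh₂ : form B₂ h < 0) (hh₃ : form B₃ h < 0) :
    ∃ y, form B₀ y < 0 ∧ form B₁ y < 0 ∧ form B₂ y < 0 ∧ form B₃ y < 0 := by
  obtain ⟨e, he, h2, h3⟩ := exists_unit_mul_re_nonpos (sesq B₂ x h) (sesq B₃ x h)
  have hnear {H : Matrix (Fin n) (Fin n) ℂ} (hH : form H x < 0) :
      ∀ᶠ ε : ℝ in nhdsWithin 0 (Set.Ioi 0), form H (x + (ε : ℂ) • e • h) < 0 := by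
    have hc : Continuous fun ε : ℝ => form H (x + (ε : ℂ) • e • h) := by fun_prop
    exact nhdsWithin_le_nhds (hc.tendsto 0 |>.eventually_lt_const (by simpa using hH))
  have hstep {H : Matrix (Fin n) (Fin n) ℂ} (hH : H.IsHermitian) (hx : form H x ≤ 0)
      (hh : form H h < 0) (hre : (e * sesq H x h).re ≤ 0) {ε : ℝ} (hε : 0 < ε) :
      form H (x + (ε : ℂ) • e • h) < 0 := by
    rw [form_add hH, form_smul, form_smul_of_norm_eq_one H he, sesq_smul_right, sesq_smul_right,
      Complex.re_ofReal_mul, Complex.norm_real, Real.norm_eq_abs, sq_abs]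
    have h4 : ε ^ 2 * form H h < 0 := mul_neg_of_pos_of_neg (by positivity) hh
    have h5 : ε * (e * sesq H x h).re ≤ 0 := mul_nonpos_of_nonneg_of_nonpos hε.le hre
    linarith
  obtain ⟨ε, ⟨h0, h1⟩, hε⟩ := ((hnear hx₀).and (hnear hx₁)).and self_mem_nhdsWithin |>.exists
  exact ⟨_, h0, h1, hstep hB₂ hx₂ hh₂ h2.le hε, hstep hB₃ hx₃ hh₃ h3 hε⟩

theorem exists_ne_zero_form_nonpos {s : Multiset (Fin n → ℂ)} {H : Matrix (Fin n) (Fin n) ℂ}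
    (h : formSum s H ≤ 0) (h1 : formSum s 1 ≠ 0) : ∃ y ∈ s, y ≠ 0 ∧ form H y ≤ 0 := by
  by_contra! hc
  have hnn : ∀ y ∈ s, 0 ≤ form H y := fun y hy => by
    by_cases hy0 : y = 0
    · rw [hy0, form_zero]
    · exact (hc y hy hy0).le
  have h0 : formSum s H = 0 := le_antisymm h (Multiset.sum_nonneg fun r hr => by
    obtain ⟨y, hy, rfl⟩ := Multiset.mem_map.mp hr
    exact hnn y hy)
  have hz := form_eq_zero_of_formSum_eq_zero h0 hnn
  refine h1 (Multiset.sum_eq_zero fun r hr => ?_)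
  obtain ⟨y, hy, rfl⟩ := Multiset.mem_map.mp hr
  by_cases hy0 : y = 0
  · rw [hy0, form_zero]
  · exact absurd (hz y hy) (hc y hy hy0).ne'

/-- The case of an optimum at which the constraint `B₁` has multiplier `0`. A rank-one
decomposition of the optimal `X` along the ray through `(tr(B₁X), tr(B₂X), tr(B₃X))` (or along the
`B₁`-axis if these traces vanish) yields an optimal vector that violates one of the two conditions
on vectors, possibly after a perturbation. -/
theorem false_of_multiplier_eq_zero {B₀ B₁ B₂ B₃ : Matrix (Fin n) (Fin n) ℂ}
    (hB₁ : B₁.IsHermitian) (hB₂ : B₂.IsHermitian) (hB₃ : B₃.IsHermitian)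
    (hneg : ∀ x, ¬ (form B₀ x < 0 ∧ form B₁ x < 0 ∧ form B₂ x < 0 ∧ form B₃ x < 0))
    (hzero : ∀ x, ¬ (form B₀ x < 0 ∧ form B₁ x = 0 ∧ form B₂ x = 0 ∧ form B₃ x = 0))
    {s₀ : Multiset (Fin n → ℂ)} (hs₀₂ : formSum s₀ B₂ < 0) (hs₀₃ : formSum s₀ B₃ < 0)
    (V : Submodule ℂ (Fin n → ℂ)) {μ₂ μ₃ μ₄ : ℝ} (hμ₄ : 0 < μ₄)
    (hV : ∀ x ∈ V, form B₀ x + μ₂ * form B₂ x + μ₃ * form B₃ x + μ₄ * form 1 x = 0)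
    {s : Multiset (Fin n → ℂ)} (hsV : ∀ y ∈ s, y ∈ V) (hs : formSum s 1 = 1)
    (hs₂ : formSum s B₂ ≤ 0) (hs₃ : formSum s B₃ ≤ 0) (hc₂ : μ₂ * formSum s B₂ = 0)
    (hc₃ : μ₃ * formSum s B₃ = 0)
    (h : formSum s B₁ < 0 ∨ formSum s B₁ = 0 ∧ formSum s B₂ = 0 ∧ formSum s B₃ = 0) : False := by
  have hs₁ : formSum s B₁ ≤ 0 := by rcases h with h | h <;> linarith [h]
  -- if the denominator vanishes, so do the numerators, and the quotients are `0`
  set r₂ := formSum s B₂ / formSum s B₁ with hr₂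
  set r₃ := formSum s B₃ / formSum s B₁ with hr₃
  have hr₂0 : 0 ≤ r₂ := div_nonneg_of_nonpos hs₂ hs₁
  have hr₃0 : 0 ≤ r₃ := div_nonneg_of_nonpos hs₃ hs₁
  have hq₂ : r₂ * formSum s B₁ = formSum s B₂ := by
    rcases h with h | ⟨h1, h2, -⟩
    · exact div_mul_cancel₀ _ h.ne
    · rw [h1, h2, mul_zero]
  have hq₃ : r₃ * formSum s B₁ = formSum s B₃ := by
    rcases h with h | ⟨h1, -, h3⟩
    · exact div_mul_cancel₀ _ h.ne
    · rw [h1, h3, mul_zero]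
  have hμr₂ : μ₂ * r₂ = 0 := by rw [hr₂, ← mul_div_assoc, hc₂, zero_div]
  have hμr₃ : μ₃ * r₃ = 0 := by rw [hr₃, ← mul_div_assoc, hc₃, zero_div]
  obtain ⟨t, ht, htsum⟩ := exists_rank_one_decomposition
    (hB₂.sub (isHermitian_real_smul hB₁ r₂)) (hB₃.sub (isHermitian_real_smul hB₁ r₃)) V s hsV
    (by rw [formSum_sub_matrix, formSum_smul_matrix, hq₂, sub_self])
    (by rw [formSum_sub_matrix, formSum_smul_matrix, hq₃, sub_self])
  obtain ⟨y, hy, hy0, hy₁⟩ := exists_ne_zero_form_nonpos ((htsum B₁ hB₁).trans_le hs₁)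
    (by rw [htsum 1 Matrix.isHermitian_one, hs]; exact one_ne_zero)
  obtain ⟨hyV, hy₂, hy₃⟩ := ht y hy
  rw [form_sub_matrix, form_smul_matrix, sub_eq_zero] at hy₂ hy₃
  have hy₀ : form B₀ y < 0 := by
    have h1 := hV y hyV
    rw [hy₂, hy₃, ← mul_assoc, ← mul_assoc, hμr₂, hμr₃] at h1
    have := mul_pos hμ₄ (form_one_pos hy0)
    linarith
  rcases hy₁.lt_or_eq with hlt | heq
  · obtain ⟨d, hd₂, hd₃⟩ := exists_form_neg_pair hB₂ hB₃ hs₀₂ hs₀₃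
    obtain ⟨x, hx⟩ := exists_all_form_neg hB₂ hB₃ hy₀ hlt
      (hy₂.trans_le (mul_nonpos_of_nonneg_of_nonpos hr₂0 hy₁))
      (hy₃.trans_le (mul_nonpos_of_nonneg_of_nonpos hr₃0 hy₁)) hd₂ hd₃
    exact hneg x hx
  · exact hzero y ⟨hy₀, heq, by rw [hy₂, heq, mul_zero], by rw [hy₃, heq, mul_zero]⟩

/-! ### The exceptional plane -/

/-- Three forms without a common zero in `V`, but with `tr(Bᵢ X) = 0` for some `X ≠ 0` on `V`:
then `V` is a plane with a basis as in Property IC. -/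
theorem exists_basis_of_no_common_zero {B₁ B₂ B₃ : Matrix (Fin n) (Fin n) ℂ}
    (hB₁ : B₁.IsHermitian) (hB₂ : B₂.IsHermitian) (hB₃ : B₃.IsHermitian)
    (V : Submodule ℂ (Fin n → ℂ))
    (hV : ∀ x ∈ V, x ≠ 0 → ¬ (form B₁ x = 0 ∧ form B₂ x = 0 ∧ form B₃ x = 0))
    {s : Multiset (Fin n → ℂ)} (hsV : ∀ y ∈ s, y ∈ V) (hs : formSum s 1 = 1)
    (hs₁ : formSum s B₁ = 0) (hs₂ : formSum s B₂ = 0) (hs₃ : formSum s B₃ = 0) :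
    ∃ x₁ x₂, Submodule.span ℂ {x₁, x₂} = V ∧
      (form B₁ x₁ = 0 ∧ form B₁ x₂ = 0 ∧ (sesq B₁ x₁ x₂).re ≠ 0) ∧
      (form B₂ x₁ = 0 ∧ form B₂ x₂ = 0 ∧
        (sesq B₂ x₁ x₂).re = 0 ∧ (sesq B₂ x₁ x₂).im ≠ 0) ∧
      (form B₃ x₁ < 0 ∧ 0 < form B₃ x₂) := by
  obtain ⟨t, ht, htsum⟩ := exists_rank_one_decomposition hB₁ hB₂ V s hsV hs₁ hs₂
  have hne : ∃ y ∈ t, form B₃ y ≠ 0 := by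
    obtain ⟨y, hy, hy0, -⟩ := exists_ne_zero_form_nonpos (H := B₃)
      ((htsum B₃ hB₃).trans_le hs₃.le)
      (by rw [htsum 1 Matrix.isHermitian_one, hs]; exact one_ne_zero)
    obtain ⟨hyV, h1, h2⟩ := ht y hy
    exact ⟨y, hy, fun h3 => hV y hyV hy0 ⟨h1, h2, h3⟩⟩
  obtain ⟨⟨x₁, hx₁, hneg⟩, y, hy, hpos⟩ :=
    exists_neg_pos_of_formSum_eq_zero ((htsum B₃ hB₃).trans hs₃) hne
  obtain ⟨hx₁V, h11, h21⟩ := ht x₁ hx₁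
  obtain ⟨hyV, h1y, h2y⟩ := ht y hy
  -- rotate the second vector to make `B₂(x₁, x₂)` imaginary
  obtain ⟨e, he, hre⟩ := exists_unit_mul_re_eq_zero (sesq B₂ x₁ y)
  obtain ⟨x₂, hx₂⟩ : ∃ x₂, x₂ = e • y := ⟨_, rfl⟩
  have hf (H : Matrix (Fin n) (Fin n) ℂ) : form H x₂ = form H y := by
    rw [hx₂, form_smul_of_norm_eq_one H he]
  have hx₂V : x₂ ∈ V := hx₂ ▸ V.smul_mem e hyV
  rw [← sesq_smul_right, ← hx₂] at hre
  rw [← hf] at h1y h2y hpos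
  -- a unit `c` that makes both off-diagonal values imaginary would give a common zero
  have hindep (c : ℂ) (hc : ‖c‖ = 1) (hc₁ : (c * sesq B₁ x₁ x₂).re = 0)
      (hc₂ : (c * sesq B₂ x₁ x₂).re = 0) : False := by
    have hfc (H : Matrix (Fin n) (Fin n) ℂ) : form H (c • x₂) = form H x₂ :=
      form_smul_of_norm_eq_one H hc x₂
    obtain ⟨a, b, -, h0, hne0⟩ := exists_real_combination_form_eq_zero B₃ hneg
      (show 0 < form B₃ (c • x₂) by rwa [hfc])
    refine hV _ (V.add_mem (V.smul_mem _ hx₁V) (V.smul_mem _ (V.smul_mem c hx₂V))) hne0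
      ⟨?_, ?_, h0⟩
    · rw [form_real_combination hB₁, hfc, sesq_smul_right, hc₁, h11, h1y]; ring
    · rw [form_real_combination hB₂, hfc, sesq_smul_right, hc₂, h21, h2y]; ring
  have hp : (sesq B₁ x₁ x₂).re ≠ 0 := fun h =>
    hindep 1 (by simp) (by simpa using h) (by simpa using hre)
  have hq : (sesq B₂ x₁ x₂).im ≠ 0 := fun h => by
    obtain ⟨c, hc, hc'⟩ := exists_unit_mul_re_eq_zero (sesq B₁ x₁ x₂)
    exact hindep c hc hc' (by rw [Complex.mul_re, hre, h]; simp)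
  refine ⟨x₁, x₂, le_antisymm ?_ fun w hw => ?_, ⟨h11, h1y, hp⟩, ⟨h21, h2y, hre, hq⟩, hneg, hpos⟩
  · rw [Submodule.span_le]
    rintro z (rfl | rfl)
    exacts [hx₁V, hx₂V]
  · by_contra hnot
    obtain ⟨a, b, h1, h2, h3⟩ := exists_common_zero_of_isotropic_pair (w := w) hB₁ hB₂ hB₃ h11 h1y
      h21 h2y (by simp [hre, hp, hq]) hneg hpos
    have hspan : a • x₁ + b • x₂ ∈ Submodule.span ℂ {x₁, x₂} :=
      Submodule.mem_span_pair.mpr ⟨a, b, rfl⟩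
    refine hV _ (V.add_mem hw (V.add_mem (V.smul_mem a hx₁V) (V.smul_mem b hx₂V))) (fun h0 => ?_)
      ⟨h1, h2, h3⟩
    rw [eq_neg_of_add_eq_zero_left h0] at hnot
    exact hnot (Submodule.neg_mem _ hspan)

/-! ### Convex duality -/

/-- A convex set that contains no point strictly below `c` lies in a half-space through `c` with
nonnegative normal vector. -/
theorem exists_weights_of_no_point_below {ι : Type*} [Fintype ι] [Nonempty ι] {W : Set (ι → ℝ)}
    (hW : Convex ℝ W) (c : ι → ℝ) (hc : ∀ w ∈ W, ¬ ∀ i, w i < c i) :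
    ∃ l : ι → ℝ, (∀ i, 0 ≤ l i) ∧ ∑ i, l i = 1 ∧
      ∀ w ∈ W, ∑ i, l i * c i ≤ ∑ i, l i * w i := by
  classical
  rcases W.eq_empty_or_nonempty with rfl | ⟨w₀, hw₀⟩
  · obtain ⟨i⟩ := ‹Nonempty ι›
    refine ⟨Pi.single i 1, fun j => ?_, by simp, by simp⟩
    by_cases h : j = i
    · subst h; simp
    · simp [h]
  have hopen : IsOpen (Set.univ.pi fun i => Set.Iio (c i)) :=
    isOpen_set_pi Set.finite_univ fun i _ => isOpen_Iio
  have hconv : Convex ℝ (Set.univ.pi fun i => Set.Iio (c i)) :=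
    convex_pi fun i _ => convex_Iio (c i)
  obtain ⟨f, u, hfu, huf⟩ := geometric_hahn_banach_open hconv hopen hW
    (Set.disjoint_left.mpr fun w hw hwW => hc w hwW fun i => hw i trivial)
  set a : ι → ℝ := fun i => f (Pi.single i 1) with ha
  have hf (z : ι → ℝ) : f z = ∑ i, a i * z i := by
    have hz : z = ∑ i, z i • (Pi.single i 1 : ι → ℝ) := by
      ext j; simp [Finset.sum_apply, Pi.single_apply]
    conv_lhs => rw [hz]
    rw [map_sum]
    refine Finset.sum_congr rfl fun i _ => ?_
    rw [map_smul, smul_eq_mul, mul_comm]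
  have hlow (z : ι → ℝ) (hz : ∀ i, z i < c i) : f z < u := hfu z fun i _ => hz i
  have hc1 : ∀ i, (c - 1) i < c i := fun i => by simp
  have ha0 (i : ι) : 0 ≤ a i := by
    by_contra! hi
    -- going down along the `i`-th axis, `f` would exceed `u`
    set T : ℝ := (u - f (c - 1)) / (-a i) with hT
    have hT0 : 0 ≤ T := div_nonneg (by linarith [hlow _ hc1]) (by linarith)
    have h1 := hlow ((c - 1) - T • (Pi.single i 1 : ι → ℝ)) fun j => by
      have h2 : 0 ≤ T * (Pi.single i 1 : ι → ℝ) j :=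
        mul_nonneg hT0 (by by_cases h : j = i <;> [(subst h; simp); simp [h]])
      have h3 := hc1 j
      simp only [Pi.sub_apply, Pi.smul_apply, smul_eq_mul] at h3 ⊢
      linarith
    rw [map_sub, map_smul, smul_eq_mul] at h1
    have h4 : T * (-a i) = u - f (c - 1) := div_mul_cancel₀ _ (by linarith)
    have h5 : f (Pi.single i 1) = a i := rfl
    rw [h5] at h1
    linarith
  have hS : 0 < ∑ i, a i := by
    refine lt_of_le_of_ne (Finset.sum_nonneg fun i _ => ha0 i) fun h0 => ?_
    have hz := (Finset.sum_eq_zero_iff_of_nonneg fun i _ => ha0 i).mp h0.symm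
    have h1 : f (c - 1) = 0 := by
      rw [hf]; exact Finset.sum_eq_zero fun i hi => by rw [hz i hi, zero_mul]
    have h2 : f w₀ = 0 := by
      rw [hf]; exact Finset.sum_eq_zero fun i hi => by rw [hz i hi, zero_mul]
    linarith [hlow _ hc1, huf w₀ hw₀]
  have hfc : f c ≤ u := by
    refine le_of_forall_pos_le_add fun δ hδ => ?_
    have hε : 0 < δ / ∑ i, a i := div_pos hδ hS
    have h1 := hlow (c - (δ / ∑ i, a i) • (1 : ι → ℝ)) fun i => by simpa using hε
    have h2 : f 1 = ∑ i, a i := by rw [hf]; simp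
    rw [map_sub, map_smul, smul_eq_mul, h2, div_mul_cancel₀ _ hS.ne'] at h1
    linarith
  have hscale (z : ι → ℝ) : ∑ i, a i / (∑ j, a j) * z i = f z / ∑ j, a j := by
    rw [hf, Finset.sum_div]
    exact Finset.sum_congr rfl fun i _ => by ring
  refine ⟨fun i => a i / ∑ j, a j, fun i => div_nonneg (ha0 i) hS.le, ?_, fun w hw => ?_⟩
  · rw [← Finset.sum_div, div_self hS.ne']
  · rw [hscale, hscale]
    gcongr
    exact hfc.trans (huf w hw)

theorem isCompact_setOf_form_one_eq_one : IsCompact {x : Fin n → ℂ | form 1 x = 1} := by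
  refine Metric.isCompact_of_isClosed_isBounded
    (isClosed_eq (continuous_form 1) continuous_const) ?_
  refine (Metric.isBounded_closedBall (x := (0 : Fin n → ℂ)) (r := 1)).subset fun x hx => ?_
  rw [mem_closedBall_zero_iff, pi_norm_le_iff_of_nonneg zero_le_one]
  intro i
  have hx' : form 1 x = 1 := hx
  rw [form_one] at hx'
  have h1 : ‖x i‖ ^ 2 ≤ 1 :=
    hx' ▸ Finset.single_le_sum (f := fun i => ‖x i‖ ^ 2) (fun j _ => by positivity)
      (Finset.mem_univ i)
  exact (sq_le_one_iff₀ (norm_nonneg _)).mp h1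

theorem form_nonneg_of_unit {H : Matrix (Fin n) (Fin n) ℂ}
    (h : ∀ x, form 1 x = 1 → 0 ≤ form H x) (x : Fin n → ℂ) : 0 ≤ form H x := by
  by_cases hx : x = 0
  · rw [hx, form_zero]
  have hpos := form_one_pos hx
  have hc : ‖((√(form 1 x))⁻¹ : ℂ)‖ ^ 2 = (form 1 x)⁻¹ := by
    rw [norm_inv, Complex.norm_real, inv_pow, Real.norm_eq_abs, sq_abs, Real.sq_sqrt hpos.le]
  have h1 := h (((√(form 1 x))⁻¹ : ℂ) • x)
    (by rw [form_smul, hc, inv_mul_cancel₀ hpos.ne'])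
  rw [form_smul, hc] at h1
  exact nonneg_of_mul_nonneg_right h1 (inv_pos.mpr hpos)

/-- The convex hull of a compact set in finite dimension is compact: by Carathéodory's theorem it
is the image of a product of a simplex and finitely many copies of the set. -/
theorem isCompact_convexHull_of_finiteDimensional {E : Type*} [NormedAddCommGroup E]
    [NormedSpace ℝ E] [FiniteDimensional ℝ E] {S : Set E} (hS : IsCompact S) :
    IsCompact (convexHull ℝ S) := by
  rcases S.eq_empty_or_nonempty with rfl | ⟨p, hp⟩
  · simp
  set N := Module.finrank ℝ E + 1 with hN
  have hK : IsCompact (stdSimplex ℝ (Fin N) ×ˢ (Set.univ.pi fun _ : Fin N => S)) :=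
    (isCompact_stdSimplex ℝ (Fin N)).prod (isCompact_univ_pi fun _ => hS)
  have hf : Continuous fun q : (Fin N → ℝ) × (Fin N → E) => ∑ k, q.1 k • q.2 k := by fun_prop
  convert hK.image hf using 1
  refine Set.Subset.antisymm (fun x hx => ?_) ?_
  · obtain ⟨κ, _, z, w, hz, hind, hw, hw1, rfl⟩ := eq_pos_convex_span_of_mem_convexHull hx
    have hcard : Fintype.card κ ≤ Fintype.card (Fin N) := by
      rw [Fintype.card_fin]
      exact hind.card_le_finrank_succ.trans (Nat.succ_le_succ (Submodule.finrank_le _))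
    obtain ⟨e⟩ := Function.Embedding.nonempty_of_card_le hcard
    -- pad the combination with zero weights at `p` to exactly `N` terms
    obtain ⟨w', hw'e, hw'0⟩ : ∃ w' : Fin N → ℝ, (∀ i, w' (e i) = w i) ∧
        ∀ k, (¬ ∃ i, e i = k) → w' k = 0 :=
      ⟨Function.extend e w fun _ => 0, e.injective.extend_apply w _,
        Function.extend_apply' w _⟩
    obtain ⟨z', hz'e, hz'0⟩ : ∃ z' : Fin N → E, (∀ i, z' (e i) = z i) ∧
        ∀ k, (¬ ∃ i, e i = k) → z' k = p :=
      ⟨Function.extend e z fun _ => p, e.injective.extend_apply z _,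
        Function.extend_apply' z _⟩
    refine ⟨(w', z'), ⟨⟨fun k => ?_, ?_⟩, fun k _ => ?_⟩, ?_⟩
    · change 0 ≤ w' k
      by_cases hk : ∃ i, e i = k
      · obtain ⟨i, rfl⟩ := hk
        rw [hw'e]; exact (hw i).le
      · rw [hw'0 k hk]
    · rw [← hw1]
      exact (Finset.sum_of_injOn e e.injective.injOn (by simp)
        (fun k _ hk => hw'0 k fun ⟨i, hi⟩ => hk ⟨i, by simp, hi⟩) fun i _ => (hw'e i).symm).symm
    · change z' k ∈ S
      by_cases hk : ∃ i, e i = k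
      · obtain ⟨i, rfl⟩ := hk
        rw [hz'e]; exact hz ⟨i, rfl⟩
      · rwa [hz'0 k hk]
    · refine (Finset.sum_of_injOn e e.injective.injOn (by simp)
        (fun k _ hk => ?_) fun i _ => ?_).symm
      · change w' k • z' k = 0
        rw [hw'0 k fun ⟨i, hi⟩ => hk ⟨i, by simp, hi⟩, zero_smul]
      · change w i • z i = w' (e i) • z' (e i)
        rw [hw'e, hz'e]
  · rintro _ ⟨⟨w, z⟩, ⟨⟨hw, hw1⟩, hz⟩, rfl⟩
    exact (convex_convexHull ℝ S).sum_mem (fun k _ => hw k) hw1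
      fun k _ => subset_convexHull ℝ S (hz k trivial)

/-- The joint numerical range of the matrices `B i`. -/
def jointRange {ι : Type*} (B : ι → Matrix (Fin n) (Fin n) ℂ) : Set (ι → ℝ) :=
  (fun x i => form (B i) x) '' {x | form 1 x = 1}

theorem isCompact_jointRange {ι : Type*} (B : ι → Matrix (Fin n) (Fin n) ℂ) :
    IsCompact (jointRange B) :=
  isCompact_setOf_form_one_eq_one.image (continuous_pi fun i => continuous_form (B i))

theorem exists_formSum_of_mem_convexHull {ι : Type*} {B : ι → Matrix (Fin n) (Fin n) ℂ}
    {w : ι → ℝ} (hw : w ∈ convexHull ℝ (jointRange B)) :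
    ∃ s : Multiset (Fin n → ℂ), (∀ i, formSum s (B i) = w i) ∧ formSum s 1 = 1 := by
  have hsmul (a : ℝ) (ha : 0 ≤ a) (s : Multiset (Fin n → ℂ)) (H : Matrix (Fin n) (Fin n) ℂ) :
      formSum (s.map fun y => ((√a : ℝ) : ℂ) • y) H = a * formSum s H := by
    induction s using Multiset.induction_on with
    | empty => simp [formSum_zero]
    | cons y s ih =>
      rw [Multiset.map_cons, formSum_cons, formSum_cons, ih, form_smul, Complex.norm_real,
        Real.norm_eq_abs, sq_abs, Real.sq_sqrt ha]
      ring
  refine convexHull_min (t := {w | ∃ s : Multiset (Fin n → ℂ),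
    (∀ i, formSum s (B i) = w i) ∧ formSum s 1 = 1}) ?_ ?_ hw
  · rintro _ ⟨x, hx, rfl⟩
    exact ⟨{x}, fun i => by simp [formSum], by simpa [formSum] using hx⟩
  · rintro w₁ ⟨s₁, h₁, h₁'⟩ w₂ ⟨s₂, h₂, h₂'⟩ a b ha hb hab
    refine ⟨(s₁.map fun y => ((√a : ℝ) : ℂ) • y) + s₂.map fun y => ((√b : ℝ) : ℂ) • y,
      fun i => ?_, ?_⟩
    · rw [formSum_add, hsmul a ha s₁, hsmul b hb s₂, h₁, h₂]
      simp
    · rw [formSum_add, hsmul a ha s₁, hsmul b hb s₂, h₁', h₂', mul_one, mul_one, hab]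

/-- If no convex combination of the `B i` is positive semidefinite, then a positive semidefinite
`X` makes all the traces `tr(Bᵢ X)` negative. -/
theorem exists_neg_mem_convexHull {ι : Type*} [Fintype ι] [Nonempty ι]
    {B : ι → Matrix (Fin n) (Fin n) ℂ} (hB : ∀ i, (B i).IsHermitian)
    (h : ¬ ∃ μ : ι → ℝ, (∀ k, 0 ≤ μ k) ∧ ∑ k, μ k = 1 ∧ (∑ k, μ k • B k).PosSemidef) :
    ∃ w ∈ convexHull ℝ (jointRange B), ∀ i, w i < 0 := by
  by_contra! hc
  obtain ⟨l, hl, hl1, hlw⟩ := exists_weights_of_no_point_below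
    (convex_convexHull ℝ (jointRange B)) 0 (fun w hw hneg => by
      obtain ⟨i, hi⟩ := hc w hw
      exact absurd (hneg i) (not_lt.mpr hi))
  refine h ⟨l, hl, hl1, posSemidef_of_form_nonneg ?_ (form_nonneg_of_unit fun x hx => ?_)⟩
  · rw [Matrix.IsHermitian, Matrix.conjTranspose_sum]
    exact Finset.sum_congr rfl fun i _ => isHermitian_real_smul (hB i) (l i)
  · have h1 := hlw _ (subset_convexHull ℝ _ ⟨x, hx, rfl⟩)
    rw [form_sum_matrix]
    simpa [form_smul_matrix] using h1

/-- Lagrange multipliers for the semidefinite program of minimizing `tr(B₀ X)` over the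
positive semidefinite `X` of trace one with `tr(Bᵢ X) ≤ 0`: an optimal `X` exists, of value
`-μ₄`, and it satisfies complementary slackness with the dual slack matrix
`B₀ + μ₁ B₁ + μ₂ B₂ + μ₃ B₃ + μ₄ I`. -/
theorem exists_multipliers {B : Fin 4 → Matrix (Fin n) (Fin n) ℂ}
    {w₀ : Fin 4 → ℝ} (hw₀ : w₀ ∈ convexHull ℝ (jointRange B)) (hneg : ∀ i, w₀ i < 0) :
    ∃ (μ₁ μ₂ μ₃ μ₄ : ℝ) (s : Multiset (Fin n → ℂ)),
      0 ≤ μ₁ ∧ 0 ≤ μ₂ ∧ 0 ≤ μ₃ ∧ 0 < μ₄ ∧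
      (∀ x, 0 ≤ form (B 0 + μ₁ • B 1 + μ₂ • B 2 + μ₃ • B 3 + μ₄ • 1) x) ∧
      (formSum s 1 = 1 ∧ formSum s (B 1) ≤ 0 ∧ formSum s (B 2) ≤ 0 ∧ formSum s (B 3) ≤ 0) ∧
      (μ₁ * formSum s (B 1) = 0 ∧ μ₂ * formSum s (B 2) = 0 ∧ μ₃ * formSum s (B 3) = 0) ∧
      formSum s (B 0 + μ₁ • B 1 + μ₂ • B 2 + μ₃ • B 3 + μ₄ • 1) = 0 := by
  have hcompact : IsCompact (convexHull ℝ (jointRange B) ∩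
      {w | w 1 ≤ 0 ∧ w 2 ≤ 0 ∧ w 3 ≤ 0}) := by
    refine (isCompact_convexHull_of_finiteDimensional (isCompact_jointRange B)).inter_right ?_
    have hclosed (i : Fin 4) : IsClosed {w : Fin 4 → ℝ | w i ≤ 0} :=
      isClosed_le (continuous_apply i) continuous_const
    exact (hclosed 1).inter ((hclosed 2).inter (hclosed 3))
  obtain ⟨w, ⟨hw, hw1, hw2, hw3⟩, hmin⟩ := hcompact.exists_isMinOn
    ⟨w₀, hw₀, (hneg 1).le, (hneg 2).le, (hneg 3).le⟩
    (f := fun w => w 0) (continuous_apply 0).continuousOn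
  have hmin' : ∀ v ∈ convexHull ℝ (jointRange B), v 1 ≤ 0 → v 2 ≤ 0 → v 3 ≤ 0 → w 0 ≤ v 0 :=
    fun v hv h1 h2 h3 => hmin ⟨hv, h1, h2, h3⟩
  obtain ⟨l, hl, hl1, hlw⟩ := exists_weights_of_no_point_below
    (convex_convexHull ℝ (jointRange B)) ![w 0, 0, 0, 0] (fun v hv hv' => by
      have h0 : v 0 < w 0 := by simpa using hv' 0
      have h1 : v 1 < 0 := by simpa using hv' 1
      have h2 : v 2 < 0 := by simpa using hv' 2
      have h3 : v 3 < 0 := by simpa using hv' 3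
      exact absurd (hmin' v hv h1.le h2.le h3.le) (not_le.mpr h0))
  simp only [Fin.sum_univ_four, Matrix.cons_val, mul_zero, add_zero] at hl1 hlw
  have hw0 : w 0 < 0 :=
    (hmin' w₀ hw₀ (hneg 1).le (hneg 2).le (hneg 3).le).trans_lt (hneg 0)
  -- Slater's condition: the strictly feasible point excludes a vanishing weight of the objective
  have hl0 : 0 < l 0 := by
    refine lt_of_le_of_ne (hl 0) fun h0 => ?_
    have h1 := hlw w₀ hw₀
    rw [← h0] at h1 hl1
    have m1 := mul_nonpos_of_nonneg_of_nonpos (hl 1) (hneg 1).le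
    have m2 := mul_nonpos_of_nonneg_of_nonpos (hl 2) (hneg 2).le
    have m3 := mul_nonpos_of_nonneg_of_nonpos (hl 3) (hneg 3).le
    have e1 := (mul_eq_zero.mp (show l 1 * w₀ 1 = 0 by linarith)).resolve_right (hneg 1).ne
    have e2 := (mul_eq_zero.mp (show l 2 * w₀ 2 = 0 by linarith)).resolve_right (hneg 2).ne
    have e3 := (mul_eq_zero.mp (show l 3 * w₀ 3 = 0 by linarith)).resolve_right (hneg 3).ne
    rw [e1, e2, e3] at hl1
    norm_num at hl1
  obtain ⟨s, hs, hs1⟩ := exists_formSum_of_mem_convexHull hw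
  have m1 := mul_nonpos_of_nonneg_of_nonpos (hl 1) hw1
  have m2 := mul_nonpos_of_nonneg_of_nonpos (hl 2) hw2
  have m3 := mul_nonpos_of_nonneg_of_nonpos (hl 3) hw3
  have hopt := hlw w hw
  have c1 : l 1 / l 0 * formSum s (B 1) = 0 := by
    rw [hs, div_mul_eq_mul_div, show l 1 * w 1 = 0 by linarith, zero_div]
  have c2 : l 2 / l 0 * formSum s (B 2) = 0 := by
    rw [hs, div_mul_eq_mul_div, show l 2 * w 2 = 0 by linarith, zero_div]
  have c3 : l 3 / l 0 * formSum s (B 3) = 0 := by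
    rw [hs, div_mul_eq_mul_div, show l 3 * w 3 = 0 by linarith, zero_div]
  refine ⟨l 1 / l 0, l 2 / l 0, l 3 / l 0, -w 0, s, div_nonneg (hl 1) hl0.le,
    div_nonneg (hl 2) hl0.le, div_nonneg (hl 3) hl0.le, neg_pos.mpr hw0,
    form_nonneg_of_unit fun x hx => ?_, ⟨hs1, ?_, ?_, ?_⟩, ⟨c1, c2, c3⟩, ?_⟩
  · have h1 := hlw _ (subset_convexHull ℝ _ ⟨x, hx, rfl⟩)
    simp only [form_add_matrix, form_smul_matrix, hx]
    have h2 : form (B 0) x + l 1 / l 0 * form (B 1) x + l 2 / l 0 * form (B 2) x +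
        l 3 / l 0 * form (B 3) x + -w 0 * 1 = (l 0 * form (B 0) x + l 1 * form (B 1) x +
          l 2 * form (B 2) x + l 3 * form (B 3) x - l 0 * w 0) / l 0 := by
      field_simp
      ring
    rw [h2]
    exact div_nonneg (by linarith) hl0.le
  · rwa [hs]
  · rwa [hs]
  · rwa [hs]
  · simp only [formSum_add_matrix, formSum_smul_matrix, c1, c2, c3, hs1]
    rw [hs]; ring

/-! ### The two implications -/

theorem exists_posSemidef_combination {B : Fin 4 → Matrix (Fin n) (Fin n) ℂ}
    (hB : ∀ i, (B i).IsHermitian) (hneg : ∀ x, ¬ ∀ i, form (B i) x < 0)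
    (hzero : ¬ ∃ x, form (B 0) x < 0 ∧ form (B 1) x = 0 ∧ form (B 2) x = 0 ∧ form (B 3) x = 0)
    (hIC : ¬ PropertyIC (B 0) (B 1) (B 2) (B 3)) :
    ∃ μ : Fin 4 → ℝ, (∀ k, 0 ≤ μ k) ∧ ∑ k, μ k = 1 ∧ (∑ k, μ k • B k).PosSemidef := by
  by_contra hcon
  obtain ⟨w₀, hw₀, hw₀neg⟩ := exists_neg_mem_convexHull hB hcon
  obtain ⟨s₀, hs₀, -⟩ := exists_formSum_of_mem_convexHull hw₀
  have hs₀neg (i : Fin 4) : formSum s₀ (B i) < 0 := (hs₀ i).trans_lt (hw₀neg i)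
  obtain ⟨μ₁, μ₂, μ₃, μ₄, s, hμ₁, hμ₂, hμ₃, hμ₄, hZ, ⟨hs, hs1, hs2, hs3⟩, ⟨hc1, hc2, hc3⟩,
    hsZ⟩ := exists_multipliers hw₀ hw₀neg
  have hneg' (x : Fin n → ℂ) (h0 : form (B 0) x < 0) (h1 : form (B 1) x < 0)
      (h2 : form (B 2) x < 0) (h3 : form (B 3) x < 0) : False :=
    hneg x fun i => by fin_cases i <;> assumption
  have hZpsd := posSemidef_of_form_nonneg ((((hB 0).add (isHermitian_real_smul (hB 1) μ₁)).add
    (isHermitian_real_smul (hB 2) μ₂)).add (isHermitian_real_smul (hB 3) μ₃) |>.add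
    (isHermitian_real_smul Matrix.isHermitian_one μ₄)) hZ
  set V := null (B 0 + μ₁ • B 1 + μ₂ • B 2 + μ₃ • B 3 + μ₄ • 1) with hVdef
  have hV (x : Fin n → ℂ) (hx : x ∈ V) : form (B 0) x + μ₁ * form (B 1) x +
      μ₂ * form (B 2) x + μ₃ * form (B 3) x + μ₄ * form 1 x = 0 := by
    have := (mem_null_iff_form_eq_zero hZpsd x).mp hx
    simpa only [form_add_matrix, form_smul_matrix] using this
  have hsV : ∀ y ∈ s, y ∈ V := fun y hy => (mem_null_iff_form_eq_zero hZpsd y).mpr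
    (form_eq_zero_of_formSum_eq_zero hsZ (fun z _ => hZ z) y hy)
  have case₁ (h : μ₁ = 0) : ¬ (formSum s (B 1) < 0 ∨
      formSum s (B 1) = 0 ∧ formSum s (B 2) = 0 ∧ formSum s (B 3) = 0) :=
    false_of_multiplier_eq_zero (B₀ := B 0) (hB 1) (hB 2) (hB 3)
      (fun x ⟨h0, h1, h2, h3⟩ => hneg' x h0 h1 h2 h3)
      (fun x ⟨h0, h1, h2, h3⟩ => hzero ⟨x, h0, h1, h2, h3⟩) (hs₀neg 2) (hs₀neg 3) V hμ₄
      (fun x hx => by have := hV x hx; rw [h] at this; linarith) hsV hs hs2 hs3 hc2 hc3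
  have case₂ (h : μ₂ = 0) : ¬ (formSum s (B 2) < 0 ∨
      formSum s (B 2) = 0 ∧ formSum s (B 1) = 0 ∧ formSum s (B 3) = 0) :=
    false_of_multiplier_eq_zero (B₀ := B 0) (hB 2) (hB 1) (hB 3)
      (fun x ⟨h0, h2, h1, h3⟩ => hneg' x h0 h1 h2 h3)
      (fun x ⟨h0, h2, h1, h3⟩ => hzero ⟨x, h0, h1, h2, h3⟩) (hs₀neg 1) (hs₀neg 3) V hμ₄
      (fun x hx => by have := hV x hx; rw [h] at this; linarith) hsV hs hs1 hs3 hc1 hc3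
  have case₃ (h : μ₃ = 0) : ¬ (formSum s (B 3) < 0 ∨
      formSum s (B 3) = 0 ∧ formSum s (B 1) = 0 ∧ formSum s (B 2) = 0) :=
    false_of_multiplier_eq_zero (B₀ := B 0) (hB 3) (hB 1) (hB 2)
      (fun x ⟨h0, h3, h1, h2⟩ => hneg' x h0 h1 h2 h3)
      (fun x ⟨h0, h3, h1, h2⟩ => hzero ⟨x, h0, h1, h2, h3⟩) (hs₀neg 1) (hs₀neg 2) V hμ₄
      (fun x hx => by have := hV x hx; rw [h] at this; linarith) hsV hs hs1 hs2 hc1 hc2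
  -- a constraint that is slack at the optimum has multiplier `0`
  have e1 : formSum s (B 1) = 0 := hs1.eq_of_not_lt fun h =>
    case₁ ((mul_eq_zero.mp hc1).resolve_right h.ne) (Or.inl h)
  have e2 : formSum s (B 2) = 0 := hs2.eq_of_not_lt fun h =>
    case₂ ((mul_eq_zero.mp hc2).resolve_right h.ne) (Or.inl h)
  have e3 : formSum s (B 3) = 0 := hs3.eq_of_not_lt fun h =>
    case₃ ((mul_eq_zero.mp hc3).resolve_right h.ne) (Or.inl h)
  have p1 : 0 < μ₁ := lt_of_le_of_ne hμ₁ fun h => case₁ h.symm (Or.inr ⟨e1, e2, e3⟩)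
  have p2 : 0 < μ₂ := lt_of_le_of_ne hμ₂ fun h => case₂ h.symm (Or.inr ⟨e2, e1, e3⟩)
  have p3 : 0 < μ₃ := lt_of_le_of_ne hμ₃ fun h => case₃ h.symm (Or.inr ⟨e3, e1, e2⟩)
  obtain ⟨x₁, x₂, hspan, hx₁, hx₂, hx₃⟩ := exists_basis_of_no_common_zero (hB 1) (hB 2) (hB 3) V
    (fun x hx hx0 ⟨h1, h2, h3⟩ => hzero ⟨x, by
      have h4 := hV x hx
      rw [h1, h2, h3] at h4
      have := mul_pos hμ₄ (form_one_pos hx0)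
      linarith, h1, h2, h3⟩) hsV hs e1 e2 e3
  exact hIC ⟨μ₁, μ₂, μ₃, μ₄, x₁, x₂, ⟨p1, p2, p3, hμ₄⟩, ⟨hZpsd, hspan⟩, hx₁, hx₂, hx₃⟩

/-- A combination of the `B i` in which `B 0` has positive weight cannot be positive semidefinite
under Property IC: on the plane of that property it would make a multiple of `B 3` positive at
both `x₁` and `x₂`. -/
theorem not_propertyIC {B : Fin 4 → Matrix (Fin n) (Fin n) ℂ} {l : Fin 4 → ℝ} (hl : 0 < l 0)
    (h : ∀ x, 0 ≤ ∑ k, l k * form (B k) x) : ¬ PropertyIC (B 0) (B 1) (B 2) (B 3) := by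
  rintro ⟨μ₁, μ₂, μ₃, μ₄, x₁, x₂, ⟨-, -, -, hμ₄⟩, ⟨hZ, hspan⟩, ⟨h11, h12, -⟩, ⟨h21, h22, -, -⟩,
    h31, h32⟩
  have key (x : Fin n → ℂ) (hx : x ∈ ({x₁, x₂} : Set (Fin n → ℂ))) (h1 : form (B 1) x = 0)
      (h2 : form (B 2) x = 0) (h3 : form (B 3) x ≠ 0) : 0 < (l 3 - l 0 * μ₃) * form (B 3) x := by
    have h4 := (mem_null_iff_form_eq_zero hZ x).mp (hspan ▸ Submodule.subset_span hx)
    simp only [form_add_matrix, form_smul_matrix, h1, h2] at h4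
    have h5 := h x
    simp only [Fin.sum_univ_four, h1, h2] at h5
    have h6 : 0 < form 1 x := form_one_pos fun h0 => h3 (by rw [h0, form_zero])
    have h7 : 0 < l 0 * (μ₄ * form 1 x) := by positivity
    have h8 : form (B 0) x = -(μ₃ * form (B 3) x + μ₄ * form 1 x) := by linarith
    rw [h8] at h5
    linarith
  have k1 := key x₁ (by simp) h11 h21 h31.ne
  have k2 := key x₂ (by simp) h12 h22 h32.ne'
  exact lt_asymm (neg_of_mul_pos_left k1 h31.le) (pos_of_mul_pos_left k2 h32.le)

end HermForms

theorem mainTheorem6 (n : ℕ) (A : Fin 4 → Matrix (Fin n) (Fin n) ℂ)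
    (hA : ∀ k, (A k).IsHermitian) :
    ((∀ x : Fin n → ℂ,
        0 ≤ max (max (HermForms.form (A 0) x) (HermForms.form (A 1) x))
              (max (HermForms.form (A 2) x) (HermForms.form (A 3) x))) ∧
      ∃ j : Equiv.Perm (Fin 4),
        (¬ ∃ x : Fin n → ℂ,
          HermForms.form (A (j 0)) x < 0 ∧ HermForms.form (A (j 1)) x = 0 ∧
          HermForms.form (A (j 2)) x = 0 ∧ HermForms.form (A (j 3)) x = 0) ∧
        ¬ HermForms.PropertyIC (A (j 0)) (A (j 1)) (A (j 2)) (A (j 3))) ↔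
    ∃ μ : Fin 4 → ℝ,
      (∀ k, 0 ≤ μ k) ∧ ∑ k, μ k = 1 ∧ (∑ k, μ k • A k).PosSemidef := by
  open HermForms in
  constructor
  · rintro ⟨hmax, j, hzero, hIC⟩
    obtain ⟨μ, hμ, hμ1, hpsd⟩ := exists_posSemidef_combination (B := fun i => A (j i))
      (fun i => hA (j i))
      (fun x hx => by
        have hx' (k : Fin 4) : form (A k) x < 0 := by simpa using hx (j.symm k)
        exact absurd (hmax x) (not_le.mpr
          (max_lt (max_lt (hx' 0) (hx' 1)) (max_lt (hx' 2) (hx' 3)))))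
      hzero hIC
    refine ⟨fun k => μ (j.symm k), fun k => hμ _, (Equiv.sum_comp j.symm μ).trans hμ1, ?_⟩
    rw [← Equiv.sum_comp j]
    simpa using hpsd
  · rintro ⟨μ, hμ, hμ1, hpsd⟩
    have hform (x : Fin n → ℂ) : 0 ≤ ∑ k, μ k * form (A k) x := by
      have := form_nonneg_of_posSemidef hpsd x
      simpa only [form_sum_matrix, form_smul_matrix] using this
    obtain ⟨k₀, hk₀⟩ : ∃ k, 0 < μ k := by
      by_contra! hc
      have : ∑ k, μ k ≤ 0 := Finset.sum_nonpos fun k _ => hc k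
      linarith
    refine ⟨fun x => ?_, Equiv.swap 0 k₀, ?_, ?_⟩
    · by_contra! hc
      obtain ⟨⟨h0, h1⟩, h2, h3⟩ : (form (A 0) x < 0 ∧ form (A 1) x < 0) ∧
          form (A 2) x < 0 ∧ form (A 3) x < 0 := by simpa using hc
      have hlt (k : Fin 4) : form (A k) x < 0 := by fin_cases k <;> assumption
      refine absurd (hform x) (not_le.mpr (Finset.sum_neg' (fun k _ =>
        mul_nonpos_of_nonneg_of_nonpos (hμ k) (hlt k).le)
        ⟨k₀, Finset.mem_univ _, mul_neg_of_pos_of_neg hk₀ (hlt k₀)⟩))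
    all_goals
      have hform' (x : Fin n → ℂ) :
          0 ≤ ∑ k, μ (Equiv.swap 0 k₀ k) * form (A (Equiv.swap 0 k₀ k)) x := by
        rw [Equiv.sum_comp (Equiv.swap 0 k₀) fun k => μ k * form (A k) x]
        exact hform x
      have hpos : 0 < μ (Equiv.swap 0 k₀ 0) := by rwa [Equiv.swap_apply_left]
    · rintro ⟨x, h0, h1, h2, h3⟩
      have h4 := hform' x
      rw [Fin.sum_univ_four, h1, h2, h3] at h4
      linarith [mul_neg_of_pos_of_neg hpos h0]
    · exact not_propertyIC (B := fun k => A (Equiv.swap 0 k₀ k))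
        (l := fun k => μ (Equiv.swap 0 k₀ k)) hpos hform'
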